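/- For an integer $q\ge 2$ and a metric space $(X,d_X)$, the $q$-extent of $X$ is $$\mathrm{xt}_q(X)=\binom{q}{2}^{-1}\sup_{(x_1,\dots,x_q)\in X^q}\ \sum_{1\le i<j\le q}d_X(x_i,x_j).$$ Let $(M,g)$ be a smooth Riemannian manifold of dimension $n\ge 1$, possibly with boundary, let $d_g$ be its Riemannian distance, and let $x$ be an interior point of $M$. For $\varepsilon>0$ let $\bar B^M_\varepsilon(x)=\{y\in M : d_g(x,y)\le\varepsilon\}$ and $\bar B^{\mathbb{R}^n}_\varepsilon=\{y\in\mathbb{R}^n : |y|\le\varepsilon\}$, with the distances $d_g$ and $|\cdot-\cdot|$ restricted to them. Then the limit below exists and $$\mathrm{Scal}_g(x)=\lim_{\varepsilon\to 0^+}\frac{12n^2}{\varepsilon^2}\left(1-\frac{\mathrm{xt}_{n+1}\big(\bar B^M_\varepsilon(x)\big)}{\mathrm{xt}_{n+1}\big(\bar B^{\mathbb{R}^n}_\varepsilon\big)}\right),$$ where $\mathrm{Scal}_g(x)$ is the scalar curvature of $g$ at $x$, i.e. the trace with respect to $g$ of the Ricci tensor (normalized so that the unit sphere $\mathbb{S}^n$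 has scalar curvature $n(n-1)$). -/

import Mathlib

open scoped Manifold ContDiff Bundle ENNReal

noncomputable section

/-- The `q`-extent of a metric space `X`: the maximal (supremal) average of the pairwise distances
of `q` points of `X`. It takes values in `[0, ∞]`, as do the distances of `X`. -/
def extent (q : ℕ) (X : Type*) [PseudoEMetricSpace X] : ℝ≥0∞ :=
  (q.choose 2 : ℝ≥0∞)⁻¹ * ⨆ p : Fin q → X, ∑ i, ∑ j ∈ Finset.Ioi i, edist (p i) (p j)

namespace RiemannianCoord

variable {n : ℕ} {H : Type*} [TopologicalSpace H]
  (I : ModelWithCorners ℝ (EuclideanSpace ℝ (Fin n)) H)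
  {M : Type*} [TopologicalSpace M] [ChartedSpace H M]

/-- The partial derivative `∂ᵢ f` of a function of the coordinates. The coordinates range over
`Set.range I`, which is a neighbourhood of the coordinates of every interior point. -/
def partialDeriv (i : Fin n) (f : EuclideanSpace ℝ (Fin n) → ℝ)
    (y : EuclideanSpace ℝ (Fin n)) : ℝ :=
  fderivWithin ℝ f (Set.range I) y (EuclideanSpace.single i 1)

/-- The coordinate vector field `∂ᵢ` of the preferred chart at `x`, at the point with
coordinates `y`. -/
def coordVector (x : M) (i : Fin n) (y : EuclideanSpace ℝ (Fin n)) :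
    TangentSpace I ((extChartAt I x).symm y) :=
  mfderivWithin 𝓘(ℝ, EuclideanSpace ℝ (Fin n)) I (extChartAt I x).symm (Set.range I) y
    (EuclideanSpace.single i (1 : ℝ) : EuclideanSpace ℝ (Fin n))

variable [Bundle.RiemannianBundle (fun x : M ↦ TangentSpace I x)]

/-- The matrix `g_{ij} = g(∂ᵢ, ∂ⱼ)` of the Riemannian metric in the preferred chart at `x`. -/
def metricMatrix (x : M) (y : EuclideanSpace ℝ (Fin n)) : Matrix (Fin n) (Fin n) ℝ :=
  Matrix.of fun i j ↦ inner ℝ (coordVector I x i y) (coordVector I x j y)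

/-- The Christoffel symbol
`Γᵏᵢⱼ = ½ ∑ₗ gᵏˡ (∂ᵢ g_{jl} + ∂ⱼ g_{il} - ∂ₗ g_{ij})` of the Levi-Civita connection. -/
def christoffel (x : M) (k i j : Fin n) (y : EuclideanSpace ℝ (Fin n)) : ℝ :=
  (1 / 2) * ∑ l, (metricMatrix I x y)⁻¹ k l *
    (partialDeriv I i (fun z ↦ metricMatrix I x z j l) y
      + partialDeriv I j (fun z ↦ metricMatrix I x z i l) y
      - partialDeriv I l (fun z ↦ metricMatrix I x z i j) y)

/-- The components `Rˡᵢⱼₖ` of the Riemann tensor, `R(∂ᵢ, ∂ⱼ) ∂ₖ = ∑ₗ Rˡᵢⱼₖ ∂ₗ`, where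
`R(X, Y) Z = ∇_X ∇_Y Z - ∇_Y ∇_X Z - ∇_{[X, Y]} Z`. -/
def riemann (x : M) (l i j k : Fin n) (y : EuclideanSpace ℝ (Fin n)) : ℝ :=
  partialDeriv I i (christoffel I x l j k) y - partialDeriv I j (christoffel I x l i k) y
    + ∑ p, (christoffel I x l i p y * christoffel I x p j k y
      - christoffel I x l j p y * christoffel I x p i k y)

/-- The Ricci tensor `Ric(∂ⱼ, ∂ₖ)`, the trace of `X ↦ R(X, ∂ⱼ) ∂ₖ`. -/
def ricci (x : M) (j k : Fin n) (y : EuclideanSpace ℝ (Fin n)) : ℝ :=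
  ∑ i, riemann I x i i j k y

end RiemannianCoord

/-- The scalar curvature at `x`, that is the trace `∑ⱼₖ gʲᵏ Ric(∂ⱼ, ∂ₖ)` of the Ricci tensor with
respect to the metric, computed in the preferred chart at `x`. -/
def scalarCurvature {n : ℕ} {H : Type*} [TopologicalSpace H]
    (I : ModelWithCorners ℝ (EuclideanSpace ℝ (Fin n)) H)
    {M : Type*} [TopologicalSpace M] [ChartedSpace H M]
    [Bundle.RiemannianBundle (fun x : M ↦ TangentSpace I x)] (x : M) : ℝ :=
  ∑ j, ∑ k, (RiemannianCoord.metricMatrix I x (extChartAt I x x))⁻¹ j k *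
    RiemannianCoord.ricci I x j k (extChartAt I x x)

end

/-!
In normal coordinates at `x`, after a polynomial change of coordinates determined by the 2-jet of
the metric, the squared length of `a` at the point `z` is `‖a‖² - R(a, z, z, a) / 3`, up to an
error `o(‖z‖²) ‖a‖²`. Hence the distance of two points `u` and `v` near the origin is
`‖v - u‖ - R(v - u, u, u, v - u) / (6 ‖v - u‖)`, up to an error `o(ε²) ‖v - u‖` on the ball of
radius `ε`: segments give the upper bound, and a function whose gradient has almost unit length
gives the lower one. Among `n + 1` points of the Euclidean unit ball, exactly the vertices of an
inscribed regular simplex maximize the sum of the pairwise distances. They form a tight frame, so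
the sum of the curvature terms over them is a multiple of the scalar curvature, the same for every
such simplex. By compactness other maximizers of the perturbed sum can only be better by a higher
order term.
-/

noncomputable section

open Set Filter Topology Asymptotics
open scoped RealInnerProductSpace

section Shortcuts

-- Without these shortcuts instance search fails on spaces of iterated continuous linear maps.

variable (E F : Type*) [NormedAddCommGroup E] [NormedSpace ℝ E] [NormedAddCommGroup F]
  [NormedSpace ℝ F]

instance bilinNormedAddCommGroup : NormedAddCommGroup (E →L[ℝ] F →L[ℝ] ℝ) := inferInstance

instance bilinAddCommMonoid : AddCommMonoid (E →L[ℝ] F →L[ℝ] ℝ) := inferInstance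

instance bilinAddMonoid : AddMonoid (E →L[ℝ] F →L[ℝ] ℝ) := inferInstance

instance bilinModule : Module ℝ (E →L[ℝ] F →L[ℝ] ℝ) := inferInstance

instance bilinNormedSpace : NormedSpace ℝ (E →L[ℝ] F →L[ℝ] ℝ) := inferInstance

instance trilinNormedAddCommGroup : NormedAddCommGroup (E →L[ℝ] E →L[ℝ] E →L[ℝ] ℝ) :=
  inferInstance

instance trilinAddCommMonoid : AddCommMonoid (E →L[ℝ] E →L[ℝ] E →L[ℝ] ℝ) := inferInstance

instance trilinAddMonoid : AddMonoid (E →L[ℝ] E →L[ℝ] E →L[ℝ] ℝ) := inferInstance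

instance trilinModule : Module ℝ (E →L[ℝ] E →L[ℝ] E →L[ℝ] ℝ) := inferInstance

instance trilinNormedSpace : NormedSpace ℝ (E →L[ℝ] E →L[ℝ] E →L[ℝ] ℝ) := inferInstance

end Shortcuts

namespace RiemannianCoord

variable {n : ℕ} {H : Type*} [TopologicalSpace H]
  (I : ModelWithCorners ℝ (EuclideanSpace ℝ (Fin n)) H)

local notation "𝔼" => EuclideanSpace ℝ (Fin n)

section MetricForm

variable {M : Type*} [TopologicalSpace M] [ChartedSpace H M]

/-- The derivative of the inverse of the preferred chart at `x`, at the point with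
coordinates `y`. -/
def chartDeriv (x : M) (y : 𝔼) : 𝔼 →L[ℝ] TangentSpace I ((extChartAt I x).symm y) :=
  mfderivWithin 𝓘(ℝ, 𝔼) I (extChartAt I x).symm (range I) y

lemma chartDeriv_eq_sum (x : M) (y a : 𝔼) :
    chartDeriv I x y a = ∑ i, a i • coordVector I x i y := by
  conv_lhs => rw [← (EuclideanSpace.basisFun (Fin n) ℝ).sum_repr a]
  simp only [map_sum, map_smul, EuclideanSpace.basisFun_repr, EuclideanSpace.basisFun_apply]
  rfl

lemma mfderivWithin_extChartAt_symm_comp [IsManifold I 1 M] (x : M) {c : ℝ → 𝔼} {s : Set ℝ}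
    {t : ℝ} (hc : DifferentiableWithinAt ℝ c s t) (ht : c t ∈ (extChartAt I x).target)
    (hs : s ⊆ c ⁻¹' range I) (hu : UniqueDiffWithinAt ℝ s t) :
    mfderivWithin 𝓘(ℝ, ℝ) I ((extChartAt I x).symm ∘ c) s t (1 : ℝ) =
      chartDeriv I x (c t) (derivWithin c s t) := by
  have hchain : mfderivWithin 𝓘(ℝ, ℝ) I ((extChartAt I x).symm ∘ c) s t =
      (mfderivWithin 𝓘(ℝ, 𝔼) I (extChartAt I x).symm (range I) (c t)) ∘L
        (mfderivWithin 𝓘(ℝ, ℝ) 𝓘(ℝ, 𝔼) c s t) :=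
    mfderivWithin_comp t (mdifferentiableWithinAt_extChartAt_symm ht)
      hc.mdifferentiableWithinAt hs hu.uniqueMDiffWithinAt
  rw [hchain, mfderivWithin_eq_fderivWithin]
  rfl

lemma chartDeriv_eq_symmL [IsManifold I 1 M] (x : M) {y : 𝔼} (hy : y ∈ (extChartAt I x).target) :
    chartDeriv I x y =
      (trivializationAt 𝔼 (TangentSpace I) x).symmL ℝ ((extChartAt I x).symm y) := by
  have hsource : (extChartAt I x).symm y ∈ (chartAt H x).source := by
    simpa only [extChartAt_source] using (extChartAt I x).map_target hy
  have h := TangentBundle.symmL_trivializationAt (I := I) (x₀ := x) hsource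
  rw [chartDeriv, h, (extChartAt I x).right_inv hy]

lemma extChartAt_symm_mem_baseSet [IsManifold I 1 M] (x : M) {y : 𝔼}
    (hy : y ∈ (extChartAt I x).target) :
    (extChartAt I x).symm y ∈ (trivializationAt 𝔼 (TangentSpace I) x).baseSet := by
  rw [TangentBundle.trivializationAt_baseSet, ← extChartAt_source I]
  exact (extChartAt I x).map_target hy

lemma extChartAt_target_mem_nhds_of_isInteriorPoint {x : M} (hx : I.IsInteriorPoint x) :
    (extChartAt I x).target ∈ 𝓝 (extChartAt I x x) := by
  rw [← nhdsWithin_eq_nhds.2 (mem_interior_iff_mem_nhds.1 hx)]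
  exact extChartAt_target_mem_nhdsWithin x

lemma coordVector_eq_localFrame [IsManifold I 1 M] (x : M) {y : 𝔼}
    (hy : y ∈ (extChartAt I x).target) (k : Fin n) :
    coordVector I x k y = (trivializationAt 𝔼 (TangentSpace I) x).localFrame
      (EuclideanSpace.basisFun (Fin n) ℝ).toBasis k ((extChartAt I x).symm y) := by
  have hb := extChartAt_symm_mem_baseSet I x hy
  have h : coordVector I x k y = chartDeriv I x y (EuclideanSpace.single k 1) := rfl
  rw [h, chartDeriv_eq_symmL I x hy, Bundle.Trivialization.localFrame_apply_of_mem_baseSet _ _ hb,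
    Bundle.Trivialization.basisAt, Module.Basis.map_apply,
    Bundle.Trivialization.linearEquivAt_symm_apply, OrthonormalBasis.coe_toBasis,
    EuclideanSpace.basisFun_apply]
  exact Bundle.Trivialization.symmL_apply (R := ℝ) _ hb _

variable [Bundle.RiemannianBundle (fun x : M ↦ TangentSpace I x)]

/-- The metric in the preferred chart at `x`, as a bilinear form depending on the coordinates. -/
def metricForm (x : M) (y : 𝔼) : 𝔼 →L[ℝ] 𝔼 →L[ℝ] ℝ :=
  ∑ i, ∑ j, metricMatrix I x y i j •
    (EuclideanSpace.proj i : 𝔼 →L[ℝ] ℝ).smulRight (EuclideanSpace.proj j : 𝔼 →L[ℝ] ℝ)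

lemma metricForm_apply (x : M) (y a b : 𝔼) :
    metricForm I x y a b = ∑ i, ∑ j, metricMatrix I x y i j * (a i * b j) := by
  simp [metricForm]

lemma metricForm_single (x : M) (y : 𝔼) (i j : Fin n) :
    metricForm I x y (EuclideanSpace.single i 1) (EuclideanSpace.single j 1) =
      metricMatrix I x y i j := by
  simp [metricForm_apply]

lemma inner_chartDeriv (x : M) (y a b : 𝔼) :
    inner ℝ (chartDeriv I x y a) (chartDeriv I x y b) = metricForm I x y a b := by
  simp only [chartDeriv_eq_sum, metricForm_apply, sum_inner, inner_sum, real_inner_smul_left,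
    real_inner_smul_right, metricMatrix, Matrix.of_apply]
  rw [Finset.sum_comm]
  exact Finset.sum_congr rfl fun i _ ↦ Finset.sum_congr rfl fun j _ ↦ by ring

lemma metricForm_comm (x : M) (y a b : 𝔼) : metricForm I x y a b = metricForm I x y b a := by
  rw [← inner_chartDeriv, ← inner_chartDeriv, real_inner_comm]

lemma enorm_chartDeriv (x : M) (y a : 𝔼) :
    ‖chartDeriv I x y a‖ₑ = ENNReal.ofReal √(metricForm I x y a a) := by
  rw [← inner_chartDeriv, ← norm_eq_sqrt_real_inner, ofReal_norm]

lemma metricForm_self_pos [IsManifold I 1 M] (x : M) {y : 𝔼} (hy : y ∈ (extChartAt I x).target)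
    {a : 𝔼} (ha : a ≠ 0) : 0 < metricForm I x y a a := by
  rw [← inner_chartDeriv, real_inner_self_pos, chartDeriv_eq_symmL I x hy]
  intro h
  apply ha
  rw [← Bundle.Trivialization.continuousLinearMapAt_symmL (R := ℝ) _
    (extChartAt_symm_mem_baseSet I x hy) a, h, map_zero]

section Smooth

variable [IsManifold I 3 M]
  [IsContMDiffRiemannianBundle I 2 (EuclideanSpace ℝ (Fin n)) (fun x : M ↦ TangentSpace I x)]

lemma contDiffAt_metricMatrix {x : M} (hx : I.IsInteriorPoint x) (i j : Fin n) :
    ContDiffAt ℝ 2 (fun y ↦ metricMatrix I x y i j) (extChartAt I x x) := by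
  have : IsManifold I (2 + 1) M := IsManifold.of_le (n := 3) (by norm_num)
  have : ContMDiffVectorBundle 2 𝔼 (TangentSpace I : M → Type _) I :=
    TangentBundle.contMDiffVectorBundle
  let e := trivializationAt 𝔼 (TangentSpace I : M → Type _) x
  let b := (EuclideanSpace.basisFun (Fin n) ℝ).toBasis
  have hframe (k : Fin n) := contMDiffAt_localFrame_of_mem (I := I) 2 e b k
    (FiberBundle.mem_baseSet_trivializationAt' x)
  have hsymm : ContMDiffAt 𝓘(ℝ, 𝔼) I 2 (extChartAt I x).symm (extChartAt I x x) :=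
    (contMDiffWithinAt_extChartAt_symm_range x (mem_extChartAt_target x)).contMDiffAt
      (mem_interior_iff_mem_nhds.1 hx)
  have hcomp : ContMDiffAt 𝓘(ℝ, 𝔼) 𝓘(ℝ) 2
      ((fun p : M ↦ inner ℝ (e.localFrame b i p) (e.localFrame b j p)) ∘ (extChartAt I x).symm)
      (extChartAt I x x) := by
    refine ContMDiffAt.comp (I' := I) _ ?_ hsymm
    rw [extChartAt_to_inv]
    exact (hframe i).inner_bundle (hframe j)
  refine (contMDiffAt_iff_contDiffAt.1 hcomp).congr_of_eventuallyEq ?_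
  filter_upwards [extChartAt_target_mem_nhds_of_isInteriorPoint I hx] with y hy
  simp only [metricMatrix, Matrix.of_apply, coordVector_eq_localFrame I x hy, Function.comp, e, b]

lemma contDiffAt_metricForm {x : M} (hx : I.IsInteriorPoint x) :
    ContDiffAt ℝ 2 (metricForm I x) (extChartAt I x x) :=
  ContDiffAt.sum fun i _ ↦ ContDiffAt.sum fun j _ ↦
    (contDiffAt_metricMatrix I hx i j).smul contDiffAt_const

end Smooth

end MetricForm

section Distance

open MeasureTheory Manifold

variable {M : Type*} [PseudoEMetricSpace M] [ChartedSpace H M] [IsManifold I 1 M]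
  [Bundle.RiemannianBundle (fun x : M ↦ TangentSpace I x)]

lemma pathELength_extChartAt_symm_comp (x : M) {c : ℝ → 𝔼} (hc : ContDiffOn ℝ 1 c (Icc 0 1))
    (hct : MapsTo c (Icc 0 1) (extChartAt I x).target) :
    pathELength I ((extChartAt I x).symm ∘ c) 0 1 = ∫⁻ t in Icc (0 : ℝ) 1, ENNReal.ofReal
      √(metricForm I x (c t) (derivWithin c (Icc 0 1) t) (derivWithin c (Icc 0 1) t)) := by
  rw [pathELength_eq_lintegral_mfderivWithin_Icc]
  refine setLIntegral_congr_fun measurableSet_Icc fun t ht ↦ ?_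
  simp only [← enorm_chartDeriv]
  exact congrArg (‖·‖ₑ) (mfderivWithin_extChartAt_symm_comp I x
    (hc.differentiableOn one_ne_zero t ht) (hct ht)
    (fun s hs ↦ extChartAt_target_subset_range x (hct hs)) (uniqueDiffOn_Icc zero_lt_one t ht))

lemma ofReal_abs_sub_le_mul_pathELength (x : M) {γ : ℝ → M} {f : 𝔼 → ℝ} {B : ℝ} (hB : 0 ≤ B)
    (hγ : CMDiff[Icc 0 1] 1 γ) (hsource : MapsTo γ (Icc 0 1) (extChartAt I x).source)
    (hf : ∀ t ∈ Icc (0 : ℝ) 1, ContDiffAt ℝ 1 f (extChartAt I x (γ t)))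
    (hfB : ∀ t ∈ Icc (0 : ℝ) 1, ∀ a, |fderiv ℝ f (extChartAt I x (γ t)) a| ≤
      B * √(metricForm I x (extChartAt I x (γ t)) a a)) :
    ENNReal.ofReal |f (extChartAt I x (γ 1)) - f (extChartAt I x (γ 0))| ≤
      ENNReal.ofReal B * pathELength I γ 0 1 := by
  set c : ℝ → 𝔼 := extChartAt I x ∘ γ
  have hcd : ContDiffOn ℝ 1 c (Icc 0 1) := by
    rw [← contMDiffOn_iff_contDiffOn]
    refine contMDiffOn_extChartAt.comp (I' := I) (t := (chartAt H x).source) hγ ?_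
    rwa [← extChartAt_source I]
  have hfc : ContDiffOn ℝ 1 (f ∘ c) (Icc 0 1) := fun t ht ↦
    (hf t ht).comp_contDiffWithinAt t (hcd t ht)
  have hγc : EqOn γ ((extChartAt I x).symm ∘ c) (Icc 0 1) := fun t ht ↦
    ((extChartAt I x).left_inv (hsource ht)).symm
  have hderiv : ∀ t ∈ Icc (0 : ℝ) 1, derivWithin (f ∘ c) (Icc 0 1) t =
      fderiv ℝ f (c t) (derivWithin c (Icc 0 1) t) := fun t ht ↦
    (((hf t ht).differentiableAt one_ne_zero).hasFDerivAt.comp_hasDerivWithinAt t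
      (hcd.differentiableOn one_ne_zero t ht).hasDerivWithinAt).derivWithin
      (uniqueDiffOn_Icc zero_lt_one t ht)
  calc ENNReal.ofReal |f (c 1) - f (c 0)|
      ≤ ∫⁻ t in Icc (0 : ℝ) 1, ‖derivWithin (f ∘ c) (Icc 0 1) t‖ₑ := by
        rw [← Real.enorm_eq_ofReal_abs]
        exact enorm_sub_le_lintegral_derivWithin_Icc_of_contDiffOn_Icc hfc zero_le_one
    _ ≤ ∫⁻ t in Icc (0 : ℝ) 1, ENNReal.ofReal B * ENNReal.ofReal
          √(metricForm I x (c t) (derivWithin c (Icc 0 1) t) (derivWithin c (Icc 0 1) t)) := by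
        refine setLIntegral_mono' measurableSet_Icc fun _ ht ↦ ?_
        rw [hderiv _ ht, Real.enorm_eq_ofReal_abs, ← ENNReal.ofReal_mul hB]
        exact ENNReal.ofReal_le_ofReal (hfB _ ht _)
    _ = ENNReal.ofReal B * pathELength I γ 0 1 := by
        rw [lintegral_const_mul' _ _ ENNReal.ofReal_ne_top, pathELength_congr hγc,
          pathELength_extChartAt_symm_comp I x hcd
            fun t ht ↦ (extChartAt I x).map_source (hsource ht)]

variable [IsRiemannianManifold I M]

lemma edist_extChartAt_symm_le (x : M) {c : ℝ → 𝔼} {B : ℝ} (hc : ContDiffOn ℝ 1 c (Icc 0 1))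
    (hct : MapsTo c (Icc 0 1) (extChartAt I x).target)
    (hB : ∀ t ∈ Icc (0 : ℝ) 1, √(metricForm I x (c t) (derivWithin c (Icc 0 1) t)
      (derivWithin c (Icc 0 1) t)) ≤ B) :
    edist ((extChartAt I x).symm (c 0)) ((extChartAt I x).symm (c 1)) ≤ ENNReal.ofReal B := by
  have hγ : CMDiff[Icc 0 1] 1 ((extChartAt I x).symm ∘ c) :=
    (contMDiffOn_extChartAt_symm x).comp (contMDiffOn_iff_contDiffOn.2 hc) hct
  calc edist ((extChartAt I x).symm (c 0)) ((extChartAt I x).symm (c 1))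
      ≤ pathELength I ((extChartAt I x).symm ∘ c) 0 1 := by
        rw [IsRiemannianManifold.out (I := I)]
        exact riemannianEDist_le_pathELength hγ rfl rfl zero_le_one
    _ ≤ ∫⁻ _ in Icc (0 : ℝ) 1, ENNReal.ofReal B := by
        rw [pathELength_extChartAt_symm_comp I x hc hct]
        exact setLIntegral_mono' measurableSet_Icc fun _ ht ↦ ENNReal.ofReal_le_ofReal (hB _ ht)
    _ = ENNReal.ofReal B := by simp

/-- A path of length less than `R` starting at `p` stays in the ball of radius `R`, so only the
derivative of `f` on that ball matters. -/
lemma ofReal_abs_sub_extChartAt_le (x : M) {p q : M} {f : 𝔼 → ℝ} {B : ℝ} {R : ℝ≥0∞}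
    (hB : 0 ≤ B) (hsource : Metric.eball p R ⊆ (extChartAt I x).source)
    (hf : ∀ z ∈ Metric.eball p R, ContDiffAt ℝ 1 f (extChartAt I x z))
    (hfB : ∀ z ∈ Metric.eball p R, ∀ a, |fderiv ℝ f (extChartAt I x z) a| ≤
      B * √(metricForm I x (extChartAt I x z) a a))
    (hpq : edist p q < R) :
    ENNReal.ofReal |f (extChartAt I x q) - f (extChartAt I x p)| ≤
      ENNReal.ofReal B * edist p q := by
  have hlength : ∀ r, edist p q < r → r ≤ R →
      ENNReal.ofReal |f (extChartAt I x q) - f (extChartAt I x p)| ≤ ENNReal.ofReal B * r := by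
    intro r hr hrR
    rw [IsRiemannianManifold.out (I := I)] at hr
    obtain ⟨γ, rfl, rfl, hγ, hlen, -⟩ :=
      exists_lt_locally_constant_of_riemannianEDist_lt hr zero_lt_one
    have hball : MapsTo γ (Icc 0 1) (Metric.eball (γ 0) R) := fun t ht ↦ by
      rw [Metric.mem_eball, edist_comm, IsRiemannianManifold.out (I := I)]
      calc riemannianEDist I (γ 0) (γ t) ≤ pathELength I γ 0 t :=
            riemannianEDist_le_pathELength hγ.contMDiffOn rfl rfl ht.1
        _ ≤ pathELength I γ 0 1 := pathELength_mono le_rfl ht.2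
        _ < R := hlen.trans_le hrR
    refine (ofReal_abs_sub_le_mul_pathELength I x hB hγ.contMDiffOn (hball.mono_right hsource)
      (fun t ht ↦ hf _ (hball ht)) fun t ht ↦ hfB _ (hball ht)).trans ?_
    gcongr
  have hne : (𝓝[>] (edist p q)).NeBot := nhdsGT_neBot_of_exists_gt ⟨R, hpq⟩
  have hlim : Tendsto (fun r ↦ ENNReal.ofReal B * r) (𝓝[>] (edist p q))
      (𝓝 (ENNReal.ofReal B * edist p q)) :=
    (ENNReal.Tendsto.const_mul tendsto_id (Or.inr ENNReal.ofReal_ne_top)).mono_left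
      nhdsWithin_le_nhds
  refine ge_of_tendsto hlim ?_
  filter_upwards [Ioc_mem_nhdsGT hpq] with r hr using hlength r hr.1 hr.2

end Distance

end RiemannianCoord

section Calculus

variable {E F : Type*} [NormedAddCommGroup E] [NormedSpace ℝ E] [NormedAddCommGroup F]
  [NormedSpace ℝ F] {f : E → F} {x : E}

lemma hasFDerivAt_fderiv_of_contDiffAt_two (hf : ContDiffAt ℝ 2 f x) :
    HasFDerivAt (fderiv ℝ f) (fderiv ℝ (fderiv ℝ f) x) x :=
  ((hf.fderiv_right (m := 1) (by norm_num)).differentiableAt one_ne_zero).hasFDerivAt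

lemma eventually_hasFDerivAt_of_contDiffAt_two (hf : ContDiffAt ℝ 2 f x) :
    ∀ᶠ y in 𝓝 x, HasFDerivAt f (fderiv ℝ f y) y := by
  filter_upwards [hf.eventually (by simp)] with y hy
  exact (hy.differentiableAt two_ne_zero).hasFDerivAt

lemma taylor_two_isLittleO (hf : ContDiffAt ℝ 2 f x) :
    (fun y ↦ f y - f x - fderiv ℝ f x (y - x)
      - (1 / 2 : ℝ) • fderiv ℝ (fderiv ℝ f) x (y - x) (y - x)) =o[𝓝 x] fun y ↦ ‖y - x‖ ^ 2 := by
  set D := fderiv ℝ (fderiv ℝ f) x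
  let ρ : E → F := fun y ↦ f y - fderiv ℝ f x (y - x) - (1 / 2 : ℝ) • D (y - x) (y - x)
  obtain ⟨r, hr, hball⟩ :=
    Metric.eventually_nhds_iff_ball.1 (eventually_hasFDerivAt_of_contDiffAt_two hf)
  have hρ : ∀ y ∈ Metric.ball x r,
      HasFDerivAt ρ (fderiv ℝ f y - fderiv ℝ f x - D (y - x)) y := by
    intro y hy
    have hsub : HasFDerivAt (fun y ↦ y - x) (ContinuousLinearMap.id ℝ E) y :=
      (hasFDerivAt_id y).sub_const x
    refine (((hball y hy).sub ((fderiv ℝ f x).hasFDerivAt.comp y hsub)).sub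
      ((D.hasFDerivAt_of_bilinear hsub hsub).const_smul (1 / 2 : ℝ))).congr_fderiv ?_
    ext v
    have hsymm : D v (y - x) = D (y - x) v := hf.isSymmSndFDerivAt (by simp) v (y - x)
    simp only [sub_apply, smul_apply, add_apply, ContinuousLinearMap.precompR_apply,
      ContinuousLinearMap.compL_apply, ContinuousLinearMap.comp_apply,
      ContinuousLinearMap.precompL_apply,
      ContinuousLinearMap.id_apply, hsymm]
    module
  have hρ' : (fun y ↦ fderiv ℝ f y - fderiv ℝ f x - D (y - x)) =o[𝓝[Metric.ball x r] x]
      fun y ↦ ‖y - x‖ ^ 1 := by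
    simpa only [pow_one] using
      (hasFDerivAt_fderiv_of_contDiffAt_two hf).isLittleO.norm_right.mono nhdsWithin_le_nhds
  have h := (convex_ball x r).isLittleO_pow_succ (Metric.mem_ball_self hr)
    (fun y hy ↦ (hρ y hy).hasFDerivWithinAt) hρ'
  rw [nhdsWithin_eq_nhds.2 (Metric.ball_mem_nhds x hr)] at h
  refine h.congr_left fun y ↦ ?_
  simp only [ρ, sub_self, map_zero, smul_zero, sub_zero]
  abel

lemma hasDerivAt_smul_const_right (z : E) (t : ℝ) : HasDerivAt (fun s : ℝ ↦ s • z) z t := by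
  simpa using (hasDerivAt_id t).smul_const z

lemma fderiv_eq_of_hasDerivAt_ray {F' : Type*} [NormedAddCommGroup F'] [NormedSpace ℝ F']
    (hf : ContDiffAt ℝ 2 f 0) (L : F →L[ℝ] F') {z : E} {η : ℝ → F'} {v : F'}
    (hη : ∀ᶠ t in 𝓝 (0 : ℝ), HasDerivAt (fun t : ℝ ↦ L (f (t • z))) (η t) t)
    (hη' : HasDerivAt η v 0) :
    L (fderiv ℝ f 0 z) = η 0 ∧ L (fderiv ℝ (fderiv ℝ f) 0 z z) = v := by
  have hray : Tendsto (fun t : ℝ ↦ t • z) (𝓝 0) (𝓝 0) := by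
    simpa using (hasDerivAt_smul_const_right z 0).continuousAt.tendsto
  have hderiv : ∀ᶠ t in 𝓝 (0 : ℝ), L (fderiv ℝ f (t • z) z) = η t := by
    filter_upwards [hη, hray.eventually (eventually_hasFDerivAt_of_contDiffAt_two hf)] with t h1 h2
    exact (L.hasFDerivAt.comp_hasDerivAt t
      (h2.comp_hasDerivAt t (hasDerivAt_smul_const_right z t))).unique h1
  have hsnd : HasFDerivAt (fderiv ℝ f) (fderiv ℝ (fderiv ℝ f) 0) ((0 : ℝ) • z) := by
    rw [zero_smul]
    exact hasFDerivAt_fderiv_of_contDiffAt_two hf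
  have hderiv' : HasDerivAt (fun t : ℝ ↦ L (fderiv ℝ f (t • z) z))
      (L (fderiv ℝ (fderiv ℝ f) 0 z z)) 0 := by
    have h : HasDerivAt (fun t : ℝ ↦ fderiv ℝ f (t • z)) (fderiv ℝ (fderiv ℝ f) 0 z) 0 :=
      hsnd.comp_hasDerivAt 0 (hasDerivAt_smul_const_right z 0)
    have h' : HasDerivAt (fun t : ℝ ↦ fderiv ℝ f (t • z) z) (fderiv ℝ (fderiv ℝ f) 0 z z) 0 := by
      simpa only [map_zero, add_zero] using h.clm_apply (hasDerivAt_const 0 z)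
    exact L.hasFDerivAt.comp_hasDerivAt 0 h'
  refine ⟨?_, hderiv'.unique (hη'.congr_of_eventuallyEq hderiv)⟩
  simpa using hderiv.self_of_nhds

end Calculus

/-! ### Second order jets of metrics -/

section Trilinear

variable {V : Type*} [NormedAddCommGroup V] [NormedSpace ℝ V]

variable (V) in
/-- The cyclic permutation `D ↦ ((a, b, c) ↦ D c a b)` of the arguments of trilinear forms. -/
def rotateForm : (V →L[ℝ] V →L[ℝ] V →L[ℝ] ℝ) →L[ℝ] (V →L[ℝ] V →L[ℝ] V →L[ℝ] ℝ) :=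
  (ContinuousLinearMap.compL ℝ V (V →L[ℝ] V →L[ℝ] ℝ) (V →L[ℝ] V →L[ℝ] ℝ)
    (ContinuousLinearMap.flipₗᵢ ℝ V V ℝ).toContinuousLinearEquiv) ∘L
    (ContinuousLinearMap.flipₗᵢ ℝ V V (V →L[ℝ] ℝ)).toContinuousLinearEquiv

@[simp] lemma rotateForm_apply (D : V →L[ℝ] V →L[ℝ] V →L[ℝ] ℝ) (a b c : V) :
    rotateForm V D a b c = D c a b := rfl

variable (V) in
/-- The Christoffel symbols of the first kind `Γ_{c,ab} = ½ (∂_a g_{bc} + ∂_b g_{ac} - ∂_c g_{ab})`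
as a function of the first derivative of a metric `g`; the lowered index comes last. -/
def christoffelForm : (V →L[ℝ] V →L[ℝ] V →L[ℝ] ℝ) →L[ℝ] (V →L[ℝ] V →L[ℝ] V →L[ℝ] ℝ) :=
  (1 / 2 : ℝ) • (ContinuousLinearMap.id ℝ (V →L[ℝ] V →L[ℝ] V →L[ℝ] ℝ)
    + (ContinuousLinearMap.flipₗᵢ ℝ V V
        (V →L[ℝ] ℝ)).toContinuousLinearEquiv.toContinuousLinearMap
    - rotateForm V)

lemma christoffelForm_apply (D : V →L[ℝ] V →L[ℝ] V →L[ℝ] ℝ) (a b c : V) :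
    christoffelForm V D a b c = 1 / 2 * (D a b c + D b a c - D c a b) := by
  simp [christoffelForm]

end Trilinear

/-- The second order jet at a point of a field of symmetric bilinear forms that is the inner product
at that point: `d1 z a b` and `d2 z w a b` are the first and second derivatives of the form
`(a, b)` in the directions `z` and `z, w`. -/
structure MetricJet (E : Type*) [NormedAddCommGroup E] [InnerProductSpace ℝ E] where
  /-- the first derivative -/
  d1 : E →L[ℝ] E →L[ℝ] E →L[ℝ] ℝ
  /-- the second derivative -/
  d2 : E →L[ℝ] E →L[ℝ] E →L[ℝ] E →L[ℝ] ℝ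
  d1_symm : ∀ z a b, d1 z a b = d1 z b a
  d2_symm : ∀ z w a b, d2 z w a b = d2 z w b a
  d2_comm : ∀ z w a b, d2 z w a b = d2 w z a b

namespace MetricJet

variable {E : Type*} [NormedAddCommGroup E] [InnerProductSpace ℝ E] [CompleteSpace E]

variable (E) in
/-- The vector dual to a linear form. -/
def raise : (E →L[ℝ] ℝ) →L[ℝ] E where
  toFun := (InnerProductSpace.toDual ℝ E).symm
  map_add' := map_add _
  map_smul' c φ := by simp
  cont := (InnerProductSpace.toDual ℝ E).symm.continuous

@[simp] lemma inner_raise (φ : E →L[ℝ] ℝ) (c : E) : ⟪raise E φ, c⟫ = φ c :=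
  InnerProductSpace.toDual_symm_apply

variable (J : MetricJet E)

/-- The Christoffel symbols of the jet. -/
def christoffel : E →L[ℝ] E →L[ℝ] E :=
  (ContinuousLinearMap.compL ℝ E (E →L[ℝ] ℝ) E (raise E)) ∘L christoffelForm E J.d1

lemma inner_christoffel (a b c : E) : ⟪J.christoffel a b, c⟫ = christoffelForm E J.d1 a b c :=
  inner_raise _ _

lemma christoffel_symm (a b : E) : J.christoffel a b = J.christoffel b a := by
  refine ext_inner_right ℝ fun c ↦ ?_
  rw [inner_christoffel, inner_christoffel, christoffelForm_apply, christoffelForm_apply,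
    J.d1_symm c a b]
  ring

lemma d1_eq (z a b : E) : J.d1 z a b = ⟪J.christoffel z a, b⟫ + ⟪J.christoffel z b, a⟫ := by
  rw [inner_christoffel, inner_christoffel, christoffelForm_apply, christoffelForm_apply,
    J.d1_symm z b a, J.d1_symm b z a]
  ring

/-- The symmetric bilinear form `(a, b) ↦ ⟨R(a, u) u, b⟩` given by the curvature tensor of
the jet. -/
def curvForm (u : E) : LinearMap.BilinForm ℝ E :=
  LinearMap.mk₂ ℝ (fun a b ↦ 1 / 2 * (J.d2 a u u b + J.d2 b u u a) - 1 / 2 * J.d2 a b u u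
    - 1 / 2 * J.d2 u u a b + ⟪J.christoffel a u, J.christoffel b u⟫
    - ⟪J.christoffel a b, J.christoffel u u⟫)
    (by intros; simp only [map_add, add_apply, inner_add_left]; ring)
    (by intros; simp only [map_smul, smul_apply, real_inner_smul_left, smul_eq_mul]; ring)
    (by intros; simp only [map_add, add_apply, inner_add_left, inner_add_right]; ring)
    (by intros; simp only [map_smul, smul_apply, real_inner_smul_left, real_inner_smul_right,
          smul_eq_mul]; ring)

/-- The sectional curvature form `⟨R(a, u) u, a⟩` of the jet. -/
def curv (a u : E) : ℝ := J.curvForm u a a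

lemma curv_eq (a u : E) : J.curv a u = J.d2 a u u a - 1 / 2 * J.d2 a a u u - 1 / 2 * J.d2 u u a a
    + ⟪J.christoffel a u, J.christoffel a u⟫ - ⟪J.christoffel a a, J.christoffel u u⟫ := by
  simp only [curv, curvForm, LinearMap.mk₂_apply]
  ring

lemma curvForm_symm (u a b : E) : J.curvForm u a b = J.curvForm u b a := by
  simp only [curvForm, LinearMap.mk₂_apply, J.d2_comm a b u u, J.d2_symm u u a b,
    J.christoffel_symm a b, real_inner_comm (J.christoffel a u)]
  ring

lemma curv_symm (a u : E) : J.curv a u = J.curv u a := by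
  simp only [curv_eq, J.d2_comm a u u a, J.d2_symm u a u a, J.christoffel_symm a u,
    real_inner_comm (J.christoffel u u)]
  ring

lemma curv_self (a : E) : J.curv a a = 0 := by
  rw [curv_eq]
  ring

lemma curv_smul_left (t : ℝ) (a u : E) : J.curv (t • a) u = t ^ 2 * J.curv a u := by
  simp only [curv, map_smul, LinearMap.smul_apply, smul_eq_mul]
  ring

lemma curv_smul_right (t : ℝ) (a u : E) : J.curv a (t • u) = t ^ 2 * J.curv a u := by
  rw [curv_symm, curv_smul_left, curv_symm]

lemma curv_add_left (a b u : E) :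
    J.curv (a + b) u = J.curv a u + 2 * J.curvForm u a b + J.curv b u := by
  simp only [curv, map_add, LinearMap.add_apply, J.curvForm_symm u b a]
  ring

lemma curvForm_self_right (a u : E) : J.curvForm u a u = 0 := by
  simp only [curvForm, LinearMap.mk₂_apply, J.d2_symm u u u a, J.christoffel_symm a u,
    real_inner_comm (J.christoffel u u)]
  ring

lemma curv_add_smul (a u : E) (t : ℝ) : J.curv a (u + t • a) = J.curv a u := by
  rw [curv_symm, curv_add_left, map_smul, curvForm_self_right, curv_smul_left, curv_self,
    curv_symm]
  simp

lemma continuous_curv : Continuous fun p : E × E ↦ J.curv p.1 p.2 := by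
  simp only [curv_eq]
  fun_prop

/-- The cubic term of the change to normal coordinates, as a multilinear form which has not been
symmetrised. -/
def cubicForm : E →L[ℝ] E →L[ℝ] E →L[ℝ] E →L[ℝ] ℝ :=
  -J.d2 + (1 / 2 : ℝ) • rotateForm E ∘L J.d2
    + (ContinuousLinearMap.compL ℝ E E (E →L[ℝ] E →L[ℝ] ℝ)
        ((3 : ℝ) • christoffelForm E J.d1 + rotateForm E (rotateForm E (christoffelForm E J.d1))))
      ∘L J.christoffel

lemma cubicForm_apply (u v w c : E) : J.cubicForm u v w c =
    -J.d2 u v w c + 1 / 2 * J.d2 u c v w + 3 * ⟪J.christoffel (J.christoffel u v) w, c⟫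
      + ⟪J.christoffel u v, J.christoffel w c⟫ := by
  rw [real_inner_comm (J.christoffel w c), inner_christoffel, inner_christoffel]
  simp only [cubicForm, add_apply, neg_apply, smul_apply, ContinuousLinearMap.comp_apply,
    ContinuousLinearMap.compL_apply, rotateForm_apply, smul_eq_mul]
  ring

/-- The cubic term of the change to normal coordinates. -/
def cubic (z : E) : E := raise E (J.cubicForm z z z)

lemma hasFDerivAt_cubic (z : E) : HasFDerivAt J.cubic
    (raise E ∘L ((J.cubicForm z z) + (J.cubicForm z).flip z + (J.cubicForm.flip z).flip z)) z := by
  have h : HasFDerivAt (fun z ↦ J.cubicForm z z z) _ z :=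
    (J.cubicForm.hasFDerivAt.clm_apply (hasFDerivAt_id z)).clm_apply (hasFDerivAt_id z)
  refine ((raise E).hasFDerivAt.comp z h).congr_fderiv ?_
  ext a
  simp
  abel

/-- The scalar curvature of a jet on `ℝⁿ` at the origin; `curv a b` is the sectional curvature of
the plane spanned by orthonormal vectors `a` and `b`. -/
def scal {n : ℕ} (J : MetricJet (EuclideanSpace ℝ (Fin n))) : ℝ :=
  ∑ b : Fin n, ∑ a : Fin n, J.curv (EuclideanSpace.single a 1) (EuclideanSpace.single b 1)

end MetricJet

section BilinearComp

variable {X E F : Type*} [NormedAddCommGroup X] [NormedSpace ℝ X] [NormedAddCommGroup E]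
  [NormedSpace ℝ E] [NormedAddCommGroup F] [NormedSpace ℝ F]

lemma contDiffAt_bilinearComp {k : WithTop ℕ∞} {x : X} {G : X → E →L[ℝ] E →L[ℝ] ℝ}
    {L : X → F →L[ℝ] E} (hG : ContDiffAt ℝ k G x) (hL : ContDiffAt ℝ k L x) :
    ContDiffAt ℝ k (fun z ↦ (G z).bilinearComp (L z) (L z)) x := by
  have hflip : ContDiffAt ℝ k (fun z ↦ ((G z) ∘L L z).flip) x :=
    (ContinuousLinearMap.flipₗᵢ ℝ F E ℝ).contDiff.contDiffAt.comp x (hG.clm_comp hL)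
  exact (ContinuousLinearMap.flipₗᵢ ℝ F F ℝ).contDiff.contDiffAt.comp x (hflip.clm_comp hL)

lemma hasDerivAt_bilin_curve {G : X → E →L[ℝ] E →L[ℝ] ℝ} {G' : X →L[ℝ] E →L[ℝ] E →L[ℝ] ℝ}
    {c : ℝ → X} {d e : ℝ → E} {c' : X} {d' e' : E} {t : ℝ} (hG : HasFDerivAt G G' (c t))
    (hc : HasDerivAt c c' t) (hd : HasDerivAt d d' t) (he : HasDerivAt e e' t) :
    HasDerivAt (fun t ↦ G (c t) (d t) (e t))
      (G' c' (d t) (e t) + G (c t) d' (e t) + G (c t) (d t) e') t :=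
  ((hG.comp_hasDerivAt t hc).clm_apply hd).clm_apply he

lemma hasDerivAt_trilin_curve {G : X → X →L[ℝ] E →L[ℝ] E →L[ℝ] ℝ}
    {G' : X →L[ℝ] X →L[ℝ] E →L[ℝ] E →L[ℝ] ℝ} {b c : ℝ → X} {d e : ℝ → E} {b' c' : X} {d' e' : E}
    {t : ℝ} (hG : HasFDerivAt G G' (b t)) (hb : HasDerivAt b b' t) (hc : HasDerivAt c c' t)
    (hd : HasDerivAt d d' t) (he : HasDerivAt e e' t) :
    HasDerivAt (fun t ↦ G (b t) (c t) (d t) (e t))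
      (G' b' (c t) (d t) (e t) + G (b t) c' (d t) (e t) + G (b t) (c t) d' (e t)
        + G (b t) (c t) (d t) e') t := by
  exact (((hG.comp_hasDerivAt t hb).clm_apply hc).clm_apply hd).clm_apply he

end BilinearComp

namespace MetricJet

variable {E : Type*} [NormedAddCommGroup E] [InnerProductSpace ℝ E] [CompleteSpace E]

section NormalMap

variable (J : MetricJet E)

lemma contDiff_cubic : ContDiff ℝ ∞ J.cubic := by
  unfold cubic
  fun_prop

lemma fderiv_cubic_apply (z a : E) : fderiv ℝ J.cubic z a =
    raise E (J.cubicForm z z a + J.cubicForm z a z + J.cubicForm a z z) := by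
  rw [(J.hasFDerivAt_cubic z).fderiv]
  rfl

lemma inner_fderiv_cubic (z a : E) : ⟪fderiv ℝ J.cubic z a, a⟫ =
    -J.d2 z z a a - J.d2 z a z a + 1 / 2 * J.d2 a a z z
      + 3 * ⟪J.christoffel (J.christoffel z z) a, a⟫
      + 6 * ⟪J.christoffel (J.christoffel z a) z, a⟫
      + ⟪J.christoffel z z, J.christoffel a a⟫ + 2 * ⟪J.christoffel z a, J.christoffel z a⟫ := by
  simp only [fderiv_cubic_apply, inner_raise, add_apply, cubicForm_apply, J.christoffel_symm a z,
    J.d2_comm a z z a, J.d2_symm z a a z]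
  ring

/-- The third order Taylor polynomial of the exponential map of the jet: a coordinate change which
makes the metric normal to second order. -/
def normalMap (z : E) : E := z - (1 / 2 : ℝ) • J.christoffel z z + (1 / 6 : ℝ) • J.cubic z

lemma contDiff_normalMap : ContDiff ℝ ∞ J.normalMap := by
  have := J.contDiff_cubic
  unfold normalMap
  fun_prop

@[simp] lemma normalMap_zero : J.normalMap 0 = 0 := by
  simp [normalMap, cubic]

lemma fderiv_normalMap (z a : E) : fderiv ℝ J.normalMap z a =
    a - J.christoffel z a + (1 / 6 : ℝ) • fderiv ℝ J.cubic z a := by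
  have hquad := J.christoffel.hasFDerivAt_of_bilinear (hasFDerivAt_id z) (hasFDerivAt_id z)
  have h : HasFDerivAt J.normalMap _ z :=
    ((hasFDerivAt_id z).sub (hquad.const_smul (1 / 2 : ℝ))).add
      ((J.contDiff_cubic.differentiable (by simp) z).hasFDerivAt.const_smul (1 / 6 : ℝ))
  rw [h.fderiv]
  simp only [smul_apply, add_apply, sub_apply, ContinuousLinearMap.precompR_apply,
    ContinuousLinearMap.compL_apply, ContinuousLinearMap.comp_apply,
    ContinuousLinearMap.precompL_apply, ContinuousLinearMap.id_apply, J.christoffel_symm a z, id]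
  module

lemma fderiv_normalMap_smul (t : ℝ) (z a : E) : fderiv ℝ J.normalMap (t • z) a =
    a - t • J.christoffel z a + (t ^ 2 / 6) • fderiv ℝ J.cubic z a := by
  simp only [fderiv_normalMap, fderiv_cubic_apply, map_smul, smul_apply, map_add]
  module

lemma fderiv_normalMap_zero : fderiv ℝ J.normalMap 0 = ContinuousLinearMap.id ℝ E := by
  ext1 a
  simp [fderiv_normalMap, fderiv_cubic_apply]

lemma hasDerivAt_normalMap_smul (t : ℝ) (z : E) :
    HasDerivAt (fun t : ℝ ↦ J.normalMap (t • z)) (fderiv ℝ J.normalMap (t • z) z) t :=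
  (J.contDiff_normalMap.differentiable (by simp) _).hasFDerivAt.comp_hasDerivAt t
    (hasDerivAt_smul_const_right z t)

lemma hasDerivAt_fderiv_normalMap_smul (t : ℝ) (z a : E) :
    HasDerivAt (fun t : ℝ ↦ fderiv ℝ J.normalMap (t • z) a)
      (-J.christoffel z a + (t / 3) • fderiv ℝ J.cubic z a) t := by
  simp only [fderiv_normalMap_smul]
  refine (((hasDerivAt_smul_const_right (J.christoffel z a) t).const_sub a).add
    (((hasDerivAt_pow 2 t).div_const 6).smul_const (fderiv ℝ J.cubic z a))).congr_deriv ?_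
  congr 2
  simp only [Nat.cast_ofNat, Nat.add_one_sub_one, pow_one]
  ring

end NormalMap

section Field

variable {G : E → E →L[ℝ] E →L[ℝ] ℝ}

omit [CompleteSpace E] in
lemma fderiv_symm_of_symm (hsymm : ∀ z a b, G z a b = G z b a) (y w a b : E) :
    fderiv ℝ G y w a b = fderiv ℝ G y w b a := by
  let flip := (ContinuousLinearMap.flipₗᵢ ℝ E E ℝ).toContinuousLinearEquiv
  have hflip : flip ∘ G = G := by
    ext z a b
    exact hsymm z b a
  have hcomp := flip.comp_fderiv (f := G) (x := y)
  rw [hflip] at hcomp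
  exact congrArg (fun L : E →L[ℝ] E →L[ℝ] E →L[ℝ] ℝ ↦ L w a b) hcomp

/-- The second order jet at `0` of a field of symmetric bilinear forms. -/
def ofField (G : E → E →L[ℝ] E →L[ℝ] ℝ) (hG : ContDiffAt ℝ 2 G 0)
    (hsymm : ∀ z a b, G z a b = G z b a) : MetricJet E where
  d1 := fderiv ℝ G 0
  d2 := fderiv ℝ (fderiv ℝ G) 0
  d1_symm := fderiv_symm_of_symm hsymm 0
  d2_symm z w a b := by
    have hderiv (a b : E) : HasFDerivAt (fun y ↦ fderiv ℝ G y w a b)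
        (((fderiv ℝ (fderiv ℝ G) 0).flip w).flip a |>.flip b) 0 := by
      have h := (((hasFDerivAt_fderiv_of_contDiffAt_two hG).clm_apply
        (hasFDerivAt_const w 0)).clm_apply (hasFDerivAt_const a 0)).clm_apply
        (hasFDerivAt_const b 0)
      exact h.congr_fderiv (by ext; simp)
    have heq := (hderiv a b).unique ((hderiv b a).congr_of_eventuallyEq
      (.of_forall fun y ↦ fderiv_symm_of_symm hsymm y w a b))
    exact congrArg (fun L : E →L[ℝ] ℝ ↦ L z) heq
  d2_comm z w a b := by
    rw [hG.isSymmSndFDerivAt (by simp) z w]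

/-- The pullback of a field `G` of bilinear forms by the change to normal coordinates. -/
def normalForm (J : MetricJet E) (G : E → E →L[ℝ] E →L[ℝ] ℝ) (z : E) : E →L[ℝ] E →L[ℝ] ℝ :=
  (G (J.normalMap z)).bilinearComp (fderiv ℝ J.normalMap z) (fderiv ℝ J.normalMap z)

lemma normalForm_apply (J : MetricJet E) (G : E → E →L[ℝ] E →L[ℝ] ℝ) (z a b : E) :
    J.normalForm G z a b =
      G (J.normalMap z) (fderiv ℝ J.normalMap z a) (fderiv ℝ J.normalMap z b) := rfl

/-- The derivative of `t ↦ J.normalForm G (t • z) a a`. -/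
def normalFormRayDeriv (J : MetricJet E) (G : E → E →L[ℝ] E →L[ℝ] ℝ) (z a : E) (t : ℝ) : ℝ :=
  fderiv ℝ G (J.normalMap (t • z)) (fderiv ℝ J.normalMap (t • z) z)
      (fderiv ℝ J.normalMap (t • z) a) (fderiv ℝ J.normalMap (t • z) a)
    + G (J.normalMap (t • z)) (-J.christoffel z a + (t / 3) • fderiv ℝ J.cubic z a)
      (fderiv ℝ J.normalMap (t • z) a)
    + G (J.normalMap (t • z)) (fderiv ℝ J.normalMap (t • z) a)
      (-J.christoffel z a + (t / 3) • fderiv ℝ J.cubic z a)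

variable {J : MetricJet E} (hG : ContDiffAt ℝ 2 G 0)

include hG

lemma contDiffAt_normalForm : ContDiffAt ℝ 2 (J.normalForm G) 0 := by
  have hψ := J.contDiff_normalMap
  refine contDiffAt_bilinearComp (ContDiffAt.comp (g := G) 0 ?_
    (hψ.contDiffAt.of_le (by norm_cast)))
    (hψ.fderiv_right (m := 2) (by norm_cast)).contDiffAt
  rwa [normalMap_zero]

lemma hasDerivAt_normalForm_ray (z a : E) :
    ∀ᶠ t in 𝓝 (0 : ℝ), HasDerivAt (fun t : ℝ ↦ J.normalForm G (t • z) a a)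
      (J.normalFormRayDeriv G z a t) t := by
  have hray : Tendsto (fun t : ℝ ↦ J.normalMap (t • z)) (𝓝 0) (𝓝 0) := by
    simpa using (J.hasDerivAt_normalMap_smul 0 z).continuousAt.tendsto
  filter_upwards [hray.eventually (eventually_hasFDerivAt_of_contDiffAt_two hG)] with t ht
  have hd := J.hasDerivAt_fderiv_normalMap_smul t z a
  simp only [normalForm_apply, normalFormRayDeriv]
  exact hasDerivAt_bilin_curve ht (J.hasDerivAt_normalMap_smul t z) hd hd

omit hG

variable (h0 : ∀ a b, G 0 a b = ⟪a, b⟫) (h1 : fderiv ℝ G 0 = J.d1)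
  (h2 : fderiv ℝ (fderiv ℝ G) 0 = J.d2)

include h0

lemma normalForm_zero (a : E) : J.normalForm G 0 a a = ‖a‖ ^ 2 := by
  rw [← real_inner_self_eq_norm_sq, ← h0]
  simp [normalForm_apply, fderiv_normalMap_zero]

include h1

lemma normalFormRayDeriv_zero (z a : E) : J.normalFormRayDeriv G z a 0 = 0 := by
  simp only [normalFormRayDeriv, zero_smul, normalMap_zero, fderiv_normalMap_zero, h1, d1_eq,
    ContinuousLinearMap.id_apply, zero_div, add_zero, h0, inner_neg_right, real_inner_comm a]
  ring

include hG h2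

lemma hasDerivAt_normalFormRayDeriv (z a : E) :
    HasDerivAt (J.normalFormRayDeriv G z a) (-(2 / 3) * J.curv a z) 0 := by
  have hfst : HasFDerivAt G J.d1 (J.normalMap ((0 : ℝ) • z)) := by
    rw [zero_smul, normalMap_zero, ← h1]
    exact (hG.differentiableAt two_ne_zero).hasFDerivAt
  have hsnd : HasFDerivAt (fderiv ℝ G) J.d2 (J.normalMap ((0 : ℝ) • z)) := by
    rw [zero_smul, normalMap_zero, ← h2]
    exact hasFDerivAt_fderiv_of_contDiffAt_two hG
  have hc := J.hasDerivAt_normalMap_smul 0 z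
  have hd (b : E) := J.hasDerivAt_fderiv_normalMap_smul 0 z b
  have hd' : HasDerivAt (fun t : ℝ ↦ -J.christoffel z a + (t / 3) • fderiv ℝ J.cubic z a)
      ((1 / 3 : ℝ) • fderiv ℝ J.cubic z a) 0 :=
    (((hasDerivAt_id (0 : ℝ)).div_const 3).smul_const (fderiv ℝ J.cubic z a)).const_add _
  refine (((hasDerivAt_trilin_curve hsnd hc (hd z) (hd a) (hd a)).add
    (hasDerivAt_bilin_curve hfst hc hd' (hd a))).add
    (hasDerivAt_bilin_curve hfst hc (hd a) hd')).congr_deriv ?_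
  simp only [zero_smul, normalMap_zero, fderiv_normalMap_zero,
    ContinuousLinearMap.id_apply, zero_div, add_zero, h0, h1, map_smul, map_neg, smul_apply,
    neg_apply, real_inner_smul_right, smul_eq_mul]
  rw [real_inner_comm (fderiv ℝ J.cubic z a) a, J.inner_fderiv_cubic z a,
    J.d1_symm z a (J.christoffel z a), J.d1_eq (J.christoffel z z) a a,
    J.d1_eq z (J.christoffel z a) a, J.curv_symm a z, curv_eq,
    J.christoffel_symm z (J.christoffel z a), J.d2_symm z a a z]
  ring

lemma fderiv_normalForm (z a : E) : fderiv ℝ (J.normalForm G) 0 z a a = 0 ∧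
    fderiv ℝ (fderiv ℝ (J.normalForm G)) 0 z z a a = -(2 / 3) * J.curv a z := by
  let ev : (E →L[ℝ] E →L[ℝ] ℝ) →L[ℝ] ℝ :=
    ContinuousLinearMap.apply ℝ ℝ a ∘L ContinuousLinearMap.apply ℝ (E →L[ℝ] ℝ) a
  rw [← normalFormRayDeriv_zero h0 h1 z a]
  exact fderiv_eq_of_hasDerivAt_ray (contDiffAt_normalForm hG) ev
    (hasDerivAt_normalForm_ray hG z a) (hasDerivAt_normalFormRayDeriv hG h0 h1 h2 z a)

lemma normalForm_expansion {δ : ℝ} (hδ : 0 < δ) :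
    ∀ᶠ z in 𝓝 (0 : E), ∀ a, |J.normalForm G z a a - (‖a‖ ^ 2 - 1 / 3 * J.curv a z)| ≤
      δ * ‖z‖ ^ 2 * ‖a‖ ^ 2 := by
  set h := J.normalForm G
  filter_upwards [(taylor_two_isLittleO (contDiffAt_normalForm hG)).bound hδ] with z hz a
  simp only [sub_zero, norm_pow, norm_norm] at hz
  have hremainder : h z a a - (‖a‖ ^ 2 - 1 / 3 * J.curv a z) =
      (h z - h 0 - fderiv ℝ h 0 z - (1 / 2 : ℝ) • fderiv ℝ (fderiv ℝ h) 0 z z) a a := by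
    obtain ⟨hfst, hsnd⟩ := fderiv_normalForm hG h0 h1 h2 z a
    simp only [sub_apply, smul_apply, h, normalForm_zero h0, hfst, hsnd, smul_eq_mul]
    ring
  rw [hremainder, ← Real.norm_eq_abs]
  refine (ContinuousLinearMap.le_opNorm₂ _ _ _).trans ?_
  rw [mul_assoc, ← sq]
  gcongr

end Field

end MetricJet

section Shortcuts

variable (V : Type*) [NormedAddCommGroup V] [NormedSpace ℝ V]

instance vectorBilinNormedAddCommGroup : NormedAddCommGroup (V →L[ℝ] V →L[ℝ] V) := inferInstance

instance vectorBilinAddCommMonoid : AddCommMonoid (V →L[ℝ] V →L[ℝ] V) := inferInstance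

instance vectorBilinModule : Module ℝ (V →L[ℝ] V →L[ℝ] V) := inferInstance

instance vectorBilinNormedSpace : NormedSpace ℝ (V →L[ℝ] V →L[ℝ] V) := inferInstance

end Shortcuts

section LeviCivita

variable {V : Type*} [NormedAddCommGroup V] [NormedSpace ℝ V] (g : V → V →L[ℝ] V →L[ℝ] ℝ)

/-- The Levi-Civita connection of a field `g` of bilinear forms, as the vector-valued bilinear form
`Γ(a, b) = ∇_a b` on constant vector fields. It is a junk value where `g` is degenerate. -/
def leviCivita (y : V) : V →L[ℝ] V →L[ℝ] V :=
  (ContinuousLinearMap.compL ℝ V (V →L[ℝ] ℝ) V (g y).inverse) ∘L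
    christoffelForm V (fderiv ℝ g y)

/-- The Riemann tensor `R(a, b) c = ∇_a ∇_b c - ∇_b ∇_a c` of a field of bilinear forms, for
constant vector fields `a`, `b` and `c`. -/
def curvatureTensor (y a b c : V) : V :=
  fderiv ℝ (leviCivita g) y a b c - fderiv ℝ (leviCivita g) y b a c
    + (leviCivita g y a (leviCivita g y b c) - leviCivita g y b (leviCivita g y a c))

/-- The form `(a, d) ↦ g(R(a, b) c, d)`, whose trace is the Ricci curvature `Ric(b, c)`. -/
def curvatureOuterForm (y b c : V) : LinearMap.BilinForm ℝ V :=
  LinearMap.mk₂ ℝ (fun a d ↦ g y (curvatureTensor g y a b c) d)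
    (fun _ _ _ ↦ by simp only [curvatureTensor, map_add, map_sub, add_apply, sub_apply]; ring)
    (fun _ _ _ ↦ by
      simp only [curvatureTensor, map_add, map_sub, map_smul, add_apply, sub_apply, smul_apply,
        smul_eq_mul]
      ring)
    (fun _ _ _ ↦ map_add _ _ _) (fun _ _ _ ↦ map_smul _ _ _)

/-- The form `(b, c) ↦ g(R(a, b) c, d)`. -/
def curvatureInnerForm (y a d : V) : LinearMap.BilinForm ℝ V :=
  LinearMap.mk₂ ℝ (fun b c ↦ g y (curvatureTensor g y a b c) d)
    (fun _ _ _ ↦ by simp only [curvatureTensor, map_add, map_sub, add_apply, sub_apply]; ring)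
    (fun _ _ _ ↦ by
      simp only [curvatureTensor, map_add, map_sub, map_smul, add_apply, sub_apply, smul_apply,
        smul_eq_mul]
      ring)
    (fun _ _ _ ↦ by simp only [curvatureTensor, map_add, map_sub, add_apply, sub_apply]; ring)
    (fun _ _ _ ↦ by
      simp only [curvatureTensor, map_add, map_sub, map_smul, add_apply, sub_apply, smul_apply,
        smul_eq_mul]
      ring)

variable {g} {y : V}

lemma leviCivita_spec (hinv : (g y).IsInvertible) (a b c : V) :
    g y (leviCivita g y a b) c = christoffelForm V (fderiv ℝ g y) a b c :=
  congrArg (fun φ : V →L[ℝ] ℝ ↦ φ c) (hinv.self_apply_inverse (christoffelForm V _ a b))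

variable (hg : ContDiffAt ℝ 2 g y) (hinv : (g y).IsInvertible)

include hg hinv

set_option synthInstance.maxHeartbeats 100000 in
-- instances on `(V →L[ℝ] ℝ) →L[ℝ] V`
lemma differentiableAt_leviCivita [CompleteSpace V] : DifferentiableAt ℝ (leviCivita g) y := by
  have hinverse : DifferentiableAt ℝ (fun z ↦ (g z).inverse) y :=
    (hinv.contDiffAt_map_inverse.differentiableAt one_ne_zero).comp y
      (hg.differentiableAt two_ne_zero)
  exact ((ContinuousLinearMap.compL ℝ V (V →L[ℝ] ℝ) V).differentiableAt.comp y hinverse).clm_comp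
    ((christoffelForm V).differentiableAt.comp y
      (hasFDerivAt_fderiv_of_contDiffAt_two hg).differentiableAt)

lemma eventually_isInvertible [CompleteSpace V] : ∀ᶠ z in 𝓝 y, (g z).IsInvertible := by
  obtain ⟨e, he⟩ := hinv
  refine hg.continuousAt.eventually ?_
  rw [← he]
  exact e.nhds

lemma fderiv_leviCivita_spec [CompleteSpace V] (v a b c : V) :
    g y (fderiv ℝ (leviCivita g) y v a b) c =
      christoffelForm V (fderiv ℝ (fderiv ℝ g) y v) a b c
        - fderiv ℝ g y v (leviCivita g y a b) c := by
  have hΓ := ((differentiableAt_leviCivita hg hinv).hasFDerivAt.clm_apply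
    (hasFDerivAt_const a y)).clm_apply (hasFDerivAt_const b y)
  have hlowered := ((hg.differentiableAt two_ne_zero).hasFDerivAt.clm_apply hΓ).clm_apply
    (hasFDerivAt_const c y)
  have hform := ((((christoffelForm V).hasFDerivAt.comp y
    (hasFDerivAt_fderiv_of_contDiffAt_two hg)).clm_apply (hasFDerivAt_const a y)).clm_apply
    (hasFDerivAt_const b y)).clm_apply (hasFDerivAt_const c y)
  have heq : (fun z ↦ g z (leviCivita g z a b) c) =ᶠ[𝓝 y]
      fun z ↦ christoffelForm V (fderiv ℝ g z) a b c := by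
    filter_upwards [eventually_isInvertible hg hinv] with z hz using leviCivita_spec hz a b c
  have h := congrArg (fun φ : V →L[ℝ] ℝ ↦ φ v) (hlowered.unique (hform.congr_of_eventuallyEq heq))
  simp only [add_apply, ContinuousLinearMap.comp_apply, ContinuousLinearMap.flip_apply,
    zero_apply, map_zero, zero_add] at h
  exact eq_sub_of_add_eq h

lemma curvatureTensor_spec [CompleteSpace V] (a b c d : V) :
    g y (curvatureTensor g y a b c) d =
      christoffelForm V (fderiv ℝ (fderiv ℝ g) y a) b c d
        - christoffelForm V (fderiv ℝ (fderiv ℝ g) y b) a c d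
        - fderiv ℝ g y a (leviCivita g y b c) d + fderiv ℝ g y b (leviCivita g y a c) d
        + christoffelForm V (fderiv ℝ g y) a (leviCivita g y b c) d
        - christoffelForm V (fderiv ℝ g y) b (leviCivita g y a c) d := by
  simp only [curvatureTensor, map_add, map_sub, add_apply, sub_apply,
    fderiv_leviCivita_spec hg hinv, leviCivita_spec hinv]
  ring

end LeviCivita

namespace MetricJet

variable {E V : Type*} [NormedAddCommGroup E] [InnerProductSpace ℝ E] [CompleteSpace E]
  [NormedAddCommGroup V] [NormedSpace ℝ V] {J : MetricJet E} {g : V → V →L[ℝ] V →L[ℝ] ℝ} {y : V}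
  {L : E ≃L[ℝ] V} (hinv : (g y).IsInvertible) (h0 : ∀ a b, g y (L a) (L b) = ⟪a, b⟫)
  (h1 : ∀ w a b, J.d1 w a b = fderiv ℝ g y (L w) (L a) (L b))

include hinv h0 h1

lemma leviCivita_eq_christoffel (a b : E) : leviCivita g y (L a) (L b) = L (J.christoffel a b) := by
  rw [← L.symm_apply_eq]
  refine ext_inner_right ℝ fun c ↦ ?_
  rw [← h0, L.apply_symm_apply, leviCivita_spec hinv, inner_christoffel, christoffelForm_apply,
    christoffelForm_apply, h1, h1, h1]

lemma curvatureTensor_eq_curv [CompleteSpace V] (hg : ContDiffAt ℝ 2 g y)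
    (h2 : ∀ v w a b, J.d2 v w a b = fderiv ℝ (fderiv ℝ g) y (L v) (L w) (L a) (L b)) (a u : E) :
    g y (curvatureTensor g y (L a) (L u) (L u)) (L a) = J.curv a u := by
  simp only [curvatureTensor_spec hg hinv, leviCivita_eq_christoffel hinv h0 h1,
    christoffelForm_apply, ← h1, ← h2]
  rw [curv_eq]
  simp only [d1_eq, J.d2_symm u a u a, J.christoffel_symm u a,
    J.christoffel_symm a (J.christoffel u u), J.christoffel_symm u (J.christoffel a u),
    J.christoffel_symm a (J.christoffel a u), real_inner_comm (J.christoffel u u)]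
  ring

end MetricJet

section Pullback

variable {E V : Type*} [NormedAddCommGroup E] [NormedSpace ℝ E] [NormedAddCommGroup V]
  [NormedSpace ℝ V] {g : V → V →L[ℝ] V →L[ℝ] ℝ} {y : V} (L : E →L[ℝ] V)

/-- The pullback of a field of bilinear forms by the affine map `z ↦ y + L z`. -/
def affinePullback (g : V → V →L[ℝ] V →L[ℝ] ℝ) (y : V) (z : E) : E →L[ℝ] E →L[ℝ] ℝ :=
  (g (y + L z)).bilinearComp L L

lemma contDiffAt_affinePullback {k : WithTop ℕ∞} (hg : ContDiffAt ℝ k g y) :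
    ContDiffAt ℝ k (affinePullback L g y) 0 := by
  refine contDiffAt_bilinearComp (ContDiffAt.comp (g := g) 0 ?_ (by fun_prop)) contDiffAt_const
  rwa [map_zero, add_zero]

lemma fderiv_affinePullback (hg : ContDiffAt ℝ 2 g y) :
    ∀ᶠ z in 𝓝 (0 : E), ∀ w a b, fderiv ℝ (affinePullback L g y) z w a b =
      fderiv ℝ g (y + L z) (L w) (L a) (L b) := by
  have htendsto : Tendsto (fun z ↦ y + L z) (𝓝 0) (𝓝 y) :=
    Continuous.tendsto' (by fun_prop) _ _ (by simp)
  filter_upwards [eventually_hasFDerivAt_of_contDiffAt_two (contDiffAt_affinePullback L hg),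
    htendsto.eventually (eventually_hasFDerivAt_of_contDiffAt_two hg)] with z hpull hz w a b
  have hleft := (hpull.clm_apply (hasFDerivAt_const a z)).clm_apply (hasFDerivAt_const b z)
  have hright := ((hz.comp z (L.hasFDerivAt.const_add y)).clm_apply
    (hasFDerivAt_const (L a) z)).clm_apply (hasFDerivAt_const (L b) z)
  simpa using congrArg (fun φ : E →L[ℝ] ℝ ↦ φ w) (hleft.unique hright)

lemma fderiv_fderiv_affinePullback (hg : ContDiffAt ℝ 2 g y) (v w a b : E) :
    fderiv ℝ (fderiv ℝ (affinePullback L g y)) 0 v w a b =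
      fderiv ℝ (fderiv ℝ g) y (L v) (L w) (L a) (L b) := by
  have hg' : HasFDerivAt (fderiv ℝ g) (fderiv ℝ (fderiv ℝ g) y) (y + L 0) := by
    simpa using hasFDerivAt_fderiv_of_contDiffAt_two hg
  have hleft := (((hasFDerivAt_fderiv_of_contDiffAt_two
    (contDiffAt_affinePullback L hg)).clm_apply (hasFDerivAt_const w 0)).clm_apply
    (hasFDerivAt_const a 0)).clm_apply (hasFDerivAt_const b 0)
  have hright := (((hg'.comp 0 (L.hasFDerivAt.const_add y)).clm_apply
    (hasFDerivAt_const (L w) 0)).clm_apply (hasFDerivAt_const (L a) 0)).clm_apply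
    (hasFDerivAt_const (L b) 0)
  have heq := (fderiv_affinePullback L hg).mono fun z hz ↦ hz w a b
  simpa using congrArg (fun φ : E →L[ℝ] ℝ ↦ φ v) (hleft.unique (hright.congr_of_eventuallyEq heq))

end Pullback

section Frame

variable {n : ℕ}

local notation "𝔼" => EuclideanSpace ℝ (Fin n)

open scoped MatrixOrder Matrix.Norms.L2Operator in
lemma exists_transpose_mul_mul_eq_one_of_posDef {S : Matrix (Fin n) (Fin n) ℝ} (hS : S.PosDef) :
    ∃ A : Matrix (Fin n) (Fin n) ℝ, A.transpose * S * A = 1 ∧ S⁻¹ = A * A.transpose := by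
  obtain ⟨B, hB⟩ := CStarAlgebra.nonneg_iff_eq_star_mul_self.1 hS.posSemidef.nonneg
  rw [Matrix.star_eq_conjTranspose, Matrix.conjTranspose_eq_transpose_of_trivial] at hB
  have hdet : IsUnit B.det := by
    refine isUnit_iff_ne_zero.2 fun h ↦ hS.det_pos.ne' ?_
    rw [hB, Matrix.det_mul, h, mul_zero]
  refine ⟨B⁻¹, ?_, by rw [hB, Matrix.mul_inv_rev, Matrix.transpose_nonsing_inv]⟩
  rw [hB, Matrix.mul_assoc, Matrix.mul_assoc, Matrix.mul_nonsing_inv _ hdet, Matrix.mul_one,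
    ← Matrix.transpose_mul, Matrix.mul_nonsing_inv _ hdet, Matrix.transpose_one]

lemma sum_frame_eq {ι : Type*} [Fintype ι] {W : Fin n → Fin n → ℝ} {f : ι → 𝔼}
    (hW : ∀ i j, W i j = ∑ a, f a i * f a j) (B : LinearMap.BilinForm ℝ 𝔼) :
    ∑ i, ∑ j, W i j * B (EuclideanSpace.single i 1) (EuclideanSpace.single j 1) =
      ∑ a, B (f a) (f a) := by
  have hB (v : 𝔼) : B v v = ∑ i, ∑ j, v i * v j *
      B (EuclideanSpace.single i 1) (EuclideanSpace.single j 1) := by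
    conv_lhs => rw [← (EuclideanSpace.basisFun (Fin n) ℝ).sum_repr v]
    simp only [map_sum, map_smul, LinearMap.sum_apply, LinearMap.smul_apply, smul_eq_mul,
      EuclideanSpace.basisFun_repr, EuclideanSpace.basisFun_apply, Finset.mul_sum, mul_assoc]
    rw [Finset.sum_comm]
    exact Finset.sum_congr rfl fun i _ ↦ Finset.sum_congr rfl fun j _ ↦ mul_left_comm _ _ _
  simp only [hB, hW, Finset.sum_mul]
  exact (Finset.sum_congr rfl fun i _ ↦ Finset.sum_comm).trans Finset.sum_comm

end Frame

namespace RiemannianCoord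

variable {n : ℕ} {H : Type*} [TopologicalSpace H]
  (I : ModelWithCorners ℝ (EuclideanSpace ℝ (Fin n)) H)
  {M : Type*} [TopologicalSpace M] [ChartedSpace H M]
  [Bundle.RiemannianBundle (fun x : M ↦ TangentSpace I x)] (x : M)

local notation "𝔼" => EuclideanSpace ℝ (Fin n)

local notation "𝕖" => fun i : Fin n ↦ (EuclideanSpace.single i (1 : ℝ) : EuclideanSpace ℝ (Fin n))

lemma metricForm_eq_dotProduct (y a b : 𝔼) :
    metricForm I x y a b = a.ofLp ⬝ᵥ (metricMatrix I x y).mulVec b.ofLp := by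
  simp only [metricForm_apply, dotProduct, Matrix.mulVec, Finset.mul_sum]
  exact Finset.sum_congr rfl fun i _ ↦ Finset.sum_congr rfl fun j _ ↦ by ring

section Invertible

variable [IsManifold I 1 M] {y : EuclideanSpace ℝ (Fin n)}

lemma posDef_metricMatrix (hy : y ∈ (extChartAt I x).target) : (metricMatrix I x y).PosDef := by
  refine Matrix.PosDef.of_dotProduct_mulVec_pos ?_ fun v hv ↦ ?_
  · ext i j
    rw [Matrix.conjTranspose_apply, star_trivial, ← metricForm_single, metricForm_comm,
      metricForm_single]
  · have hpos := metricForm_self_pos I x hy (a := WithLp.toLp 2 v) (by simpa using hv)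
    rwa [metricForm_eq_dotProduct] at hpos

lemma isInvertible_metricForm (hy : y ∈ (extChartAt I x).target) :
    (metricForm I x y).IsInvertible := by
  have hinj : Function.Injective (metricForm I x y) := by
    refine (injective_iff_map_eq_zero _).2 fun a ha ↦ by_contra fun hne ↦
      (metricForm_self_pos I x hy hne).ne' ?_
    rw [ha, zero_apply]
  have hfinrank : Module.finrank ℝ 𝔼 = Module.finrank ℝ (𝔼 →L[ℝ] ℝ) := by
    rw [← LinearMap.toContinuousLinearMap.finrank_eq]
    exact Subspace.dual_finrank_eq.symm
  exact ⟨(LinearEquiv.ofInjectiveOfFinrankEq _ hinj hfinrank).toContinuousLinearEquiv, by ext; rfl⟩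

lemma apply_eq_sum_inv_metricMatrix (hy : y ∈ (extChartAt I x).target) (v : 𝔼) (k : Fin n) :
    v k = ∑ l, (metricMatrix I x y)⁻¹ k l * metricForm I x y v (𝕖 l) := by
  have hdet := (posDef_metricMatrix I x hy).det_pos.ne'.isUnit
  have hlower (l : Fin n) : metricForm I x y v (𝕖 l) =
      (metricMatrix I x y).mulVec v.ofLp l := by
    rw [metricForm_comm, metricForm_eq_dotProduct]
    simp
  simp only [hlower]
  change v k = (metricMatrix I x y)⁻¹.mulVec ((metricMatrix I x y).mulVec v.ofLp) k
  rw [Matrix.mulVec_mulVec, Matrix.nonsing_inv_mul _ hdet, Matrix.one_mulVec]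

end Invertible

section Components

variable {y : EuclideanSpace ℝ (Fin n)}

lemma partialDeriv_eq_of_hasFDerivAt {f : 𝔼 → ℝ} {f' : 𝔼 →L[ℝ] ℝ} (hy : range I ∈ 𝓝 y)
    (hf : HasFDerivAt f f' y) (i : Fin n) : partialDeriv I i f y = f' (𝕖 i) := by
  rw [partialDeriv, fderivWithin_of_mem_nhds hy, hf.fderiv]

lemma partialDeriv_metricMatrix (hy : range I ∈ 𝓝 y)
    (hg : DifferentiableAt ℝ (metricForm I x) y) (i j k : Fin n) :
    partialDeriv I i (fun z ↦ metricMatrix I x z j k) y =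
      fderiv ℝ (metricForm I x) y (𝕖 i) (𝕖 j) (𝕖 k) := by
  have h := (hg.hasFDerivAt.clm_apply (hasFDerivAt_const (𝕖 j) y)).clm_apply
    (hasFDerivAt_const (𝕖 k) y)
  simp only [metricForm_single] at h
  simpa using partialDeriv_eq_of_hasFDerivAt I hy h i

variable [IsManifold I 1 M]

lemma christoffel_eq_leviCivita (hy : (extChartAt I x).target ∈ 𝓝 y)
    (hg : DifferentiableAt ℝ (metricForm I x) y) (k i j : Fin n) :
    christoffel I x k i j y = leviCivita (metricForm I x) y (𝕖 i) (𝕖 j) k := by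
  have hrange : range I ∈ 𝓝 y := mem_of_superset hy (extChartAt_target_subset_range x)
  rw [apply_eq_sum_inv_metricMatrix I x (mem_of_mem_nhds hy), christoffel, Finset.mul_sum]
  refine Finset.sum_congr rfl fun l _ ↦ ?_
  rw [leviCivita_spec (isInvertible_metricForm I x (mem_of_mem_nhds hy)), christoffelForm_apply]
  simp only [partialDeriv_metricMatrix I x hrange hg]
  ring

set_option synthInstance.maxHeartbeats 100000 in
-- instances on spaces of vector-valued bilinear maps
lemma riemann_eq_curvatureTensor (hy : (extChartAt I x).target ∈ 𝓝 y)
    (hg : ContDiffAt ℝ 2 (metricForm I x) y) (l i j k : Fin n) :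
    riemann I x l i j k y = curvatureTensor (metricForm I x) y (𝕖 i) (𝕖 j) (𝕖 k) l := by
  have hchris (k i j : Fin n) : christoffel I x k i j =ᶠ[𝓝 y]
      fun z ↦ leviCivita (metricForm I x) z (𝕖 i) (𝕖 j) k := by
    filter_upwards [eventually_mem_nhds_iff.2 hy,
      eventually_hasFDerivAt_of_contDiffAt_two hg] with z hz hgz
    exact christoffel_eq_leviCivita I x hz hgz.differentiableAt k i j
  have hpartial (i k p q : Fin n) : partialDeriv I i (christoffel I x k p q) y =
      fderiv ℝ (leviCivita (metricForm I x)) y (𝕖 i) (𝕖 p) (𝕖 q) k := by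
    have hΓ := ((differentiableAt_leviCivita hg
      (isInvertible_metricForm I x (mem_of_mem_nhds hy))).hasFDerivAt.clm_apply
      (hasFDerivAt_const (𝕖 p) y)).clm_apply (hasFDerivAt_const (𝕖 q) y)
    have hcoord := (EuclideanSpace.proj k : 𝔼 →L[ℝ] ℝ).hasFDerivAt.comp y hΓ
    simpa using partialDeriv_eq_of_hasFDerivAt I
      (mem_of_superset hy (extChartAt_target_subset_range x))
      (hcoord.congr_of_eventuallyEq (hchris k p q)) i
  have hcomp (i j k : Fin n) :
      ∑ p, christoffel I x l i p y * christoffel I x p j k y =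
      leviCivita (metricForm I x) y (𝕖 i) (leviCivita (metricForm I x) y (𝕖 j) (𝕖 k)) l := by
    conv_rhs => rw [← (EuclideanSpace.basisFun (Fin n) ℝ).sum_repr
      (leviCivita (metricForm I x) y (𝕖 j) (𝕖 k))]
    simp [(hchris _ _ _).eq_of_nhds, mul_comm]
  simp only [riemann, hpartial, Finset.sum_sub_distrib, hcomp, curvatureTensor, PiLp.add_apply,
    PiLp.sub_apply]

end Components

end RiemannianCoord

namespace RiemannianCoord

variable {n : ℕ} {H : Type*} [TopologicalSpace H]
  (I : ModelWithCorners ℝ (EuclideanSpace ℝ (Fin n)) H)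
  {M : Type*} [TopologicalSpace M] [ChartedSpace H M]
  [Bundle.RiemannianBundle (fun x : M ↦ TangentSpace I x)] {x : M}

local notation "𝔼" => EuclideanSpace ℝ (Fin n)

local notation "𝕖" => fun i : Fin n ↦ (EuclideanSpace.single i (1 : ℝ) : EuclideanSpace ℝ (Fin n))

lemma exists_orthonormalFrame [IsManifold I 1 M] (x : M) {y : 𝔼}
    (hy : y ∈ (extChartAt I x).target) : ∃ L : 𝔼 ≃L[ℝ] 𝔼,
    (∀ a b, metricForm I x y (L a) (L b) = ⟪a, b⟫) ∧
    ∀ i j, (metricMatrix I x y)⁻¹ i j = ∑ a, L (𝕖 a) i * L (𝕖 a) j := by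
  obtain ⟨A, hA, hAinv⟩ :=
    exists_transpose_mul_mul_eq_one_of_posDef (posDef_metricMatrix I x hy)
  let L : 𝔼 →ₗ[ℝ] 𝔼 := Matrix.toEuclideanLin A
  have hinner (a b : 𝔼) : metricForm I x y (L a) (L b) = ⟪a, b⟫ := by
    change _ = b.ofLp ⬝ᵥ star a.ofLp
    rw [metricForm_eq_dotProduct, star_trivial, dotProduct_comm b.ofLp]
    change A.mulVec a.ofLp ⬝ᵥ (metricMatrix I x y).mulVec (A.mulVec b.ofLp) = _
    rw [Matrix.dotProduct_mulVec, ← Matrix.vecMul_transpose, Matrix.vecMul_vecMul,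
      Matrix.dotProduct_mulVec, Matrix.vecMul_vecMul, hA, Matrix.vecMul_one]
  have hinj : Function.Injective L := by
    refine (injective_iff_map_eq_zero L).2 fun a ha ↦ inner_self_eq_zero (𝕜 := ℝ).1 ?_
    rw [← hinner, ha, map_zero]
  refine ⟨(LinearEquiv.ofInjectiveEndo L hinj).toContinuousLinearEquiv, hinner, fun i j ↦ ?_⟩
  have hL (a i : Fin n) : L (𝕖 a) i = A i a := by simp [L]
  rw [hAinv, Matrix.mul_apply]
  exact Finset.sum_congr rfl fun a _ ↦ (congrArg₂ _ (hL a i) (hL a j)).symm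

lemma scalarCurvature_eq_sum_frame [IsManifold I 1 M] (hx : I.IsInteriorPoint x)
    (hg : ContDiffAt ℝ 2 (metricForm I x) (extChartAt I x x)) {f : Fin n → EuclideanSpace ℝ (Fin n)}
    (hf : ∀ i j, (metricMatrix I x (extChartAt I x x))⁻¹ i j = ∑ a, f a i * f a j) :
    scalarCurvature I x = ∑ b, ∑ a, metricForm I x (extChartAt I x x)
      (curvatureTensor (metricForm I x) (extChartAt I x x) (f a) (f b) (f b)) (f a) := by
  have htarget := extChartAt_target_mem_nhds_of_isInteriorPoint I hx
  let Ric : LinearMap.BilinForm ℝ 𝔼 :=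
    ∑ a, curvatureInnerForm (metricForm I x) (extChartAt I x x) (f a) (f a)
  have hRic (b c : 𝔼) : Ric b c = ∑ a, metricForm I x (extChartAt I x x)
      (curvatureTensor (metricForm I x) (extChartAt I x x) (f a) b c) (f a) := by
    simp only [Ric, LinearMap.sum_apply]
    rfl
  have hricci (j k : Fin n) : ricci I x j k (extChartAt I x x) = Ric (𝕖 j) (𝕖 k) := by
    simp only [ricci, riemann_eq_curvatureTensor I x htarget hg, hRic,
      apply_eq_sum_inv_metricMatrix I x (mem_of_mem_nhds htarget) (curvatureTensor _ _ _ _ _)]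
    exact sum_frame_eq hf
      (curvatureOuterForm (metricForm I x) (extChartAt I x x) (𝕖 j) (𝕖 k))
  simp only [scalarCurvature, hricci, ← hRic]
  exact sum_frame_eq hf Ric

variable [IsManifold I 3 M]
  [IsContMDiffRiemannianBundle I 2 (EuclideanSpace ℝ (Fin n)) (fun x : M ↦ TangentSpace I x)]

/-- The second order jet of the metric at an interior point `x`, in the affine coordinates given by
a linear map `L` into the preferred chart at `x`. -/
def frameJet (hx : I.IsInteriorPoint x) (L : 𝔼 →L[ℝ] 𝔼) : MetricJet 𝔼 :=
  MetricJet.ofField (affinePullback L (metricForm I x) (extChartAt I x x))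
    (contDiffAt_affinePullback L (contDiffAt_metricForm I hx))
    fun _ _ _ ↦ metricForm_comm I x _ _ _

lemma scal_frameJet (hx : I.IsInteriorPoint x) {L : 𝔼 ≃L[ℝ] 𝔼}
    (hL : ∀ a b, metricForm I x (extChartAt I x x) (L a) (L b) = ⟪a, b⟫)
    (hinv : ∀ i j, (metricMatrix I x (extChartAt I x x))⁻¹ i j = ∑ a, L (𝕖 a) i * L (𝕖 a) j) :
    (frameJet I hx (L : 𝔼 →L[ℝ] 𝔼)).scal = scalarCurvature I x := by
  have hg : ContDiffAt ℝ 2 (metricForm I x) (extChartAt I x x) :=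
    contDiffAt_metricForm I hx
  have hfirst (w a b : 𝔼) : (frameJet I hx (L : 𝔼 →L[ℝ] 𝔼)).d1 w a b =
      fderiv ℝ (metricForm I x) (extChartAt I x x) (L w) (L a) (L b) := by
    have h := (fderiv_affinePullback (L : 𝔼 →L[ℝ] 𝔼) hg).self_of_nhds w a b
    rwa [map_zero, add_zero] at h
  rw [scalarCurvature_eq_sum_frame I hx hg hinv, MetricJet.scal]
  refine Finset.sum_congr rfl fun b _ ↦ Finset.sum_congr rfl fun a _ ↦ ?_
  exact (MetricJet.curvatureTensor_eq_curv
    (isInvertible_metricForm I x (mem_extChartAt_target x)) hL hfirst hg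
    (fderiv_fderiv_affinePullback (L : 𝔼 →L[ℝ] 𝔼) hg) (𝕖 a) (𝕖 b)).symm

end RiemannianCoord

/-! ### The distance in normal coordinates -/

namespace MetricJet

section Bounds

variable {E : Type*} [NormedAddCommGroup E] [InnerProductSpace ℝ E] [CompleteSpace E]
  (J : MetricJet E)

/-- A bound for the curvature of the jet, as a quadrilinear form. -/
def curvBound : ℝ := 2 * ‖J.d2‖ + 2 * ‖J.christoffel‖ ^ 2

lemma curvBound_nonneg : 0 ≤ J.curvBound := by
  unfold curvBound
  positivity

omit [CompleteSpace E] in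
lemma abs_d2_le (a b c d : E) : |J.d2 a b c d| ≤ ‖J.d2‖ * (‖a‖ * ‖b‖ * ‖c‖ * ‖d‖) :=
  calc ‖J.d2 a b c d‖ ≤ ‖J.d2‖ * ‖a‖ * ‖b‖ * ‖c‖ * ‖d‖ :=
        (J.d2 a b c).le_of_opNorm_le ((J.d2 a b).le_of_opNorm_le
          ((J.d2 a).le_of_opNorm_le (J.d2.le_opNorm a) b) c) d
    _ = ‖J.d2‖ * (‖a‖ * ‖b‖ * ‖c‖ * ‖d‖) := by ring

lemma abs_inner_christoffel_le (a b c d : E) :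
    |⟪J.christoffel a b, J.christoffel c d⟫| ≤
      ‖J.christoffel‖ ^ 2 * (‖a‖ * ‖b‖ * ‖c‖ * ‖d‖) :=
  calc |⟪J.christoffel a b, J.christoffel c d⟫|
      ≤ ‖J.christoffel a b‖ * ‖J.christoffel c d‖ := abs_real_inner_le_norm _ _
    _ ≤ (‖J.christoffel‖ * ‖a‖ * ‖b‖) * (‖J.christoffel‖ * ‖c‖ * ‖d‖) := by
        gcongr <;> exact J.christoffel.le_opNorm₂ _ _
    _ = ‖J.christoffel‖ ^ 2 * (‖a‖ * ‖b‖ * ‖c‖ * ‖d‖) := by ring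

lemma abs_curvForm_le (u a b : E) :
    |J.curvForm u a b| ≤ J.curvBound * ‖u‖ ^ 2 * (‖a‖ * ‖b‖) := by
  have h1 := abs_le.1 (J.abs_d2_le a u u b)
  have h2 := abs_le.1 (J.abs_d2_le b u u a)
  have h3 := abs_le.1 (J.abs_d2_le a b u u)
  have h4 := abs_le.1 (J.abs_d2_le u u a b)
  have h5 := abs_le.1 (J.abs_inner_christoffel_le a u b u)
  have h6 := abs_le.1 (J.abs_inner_christoffel_le a b u u)
  rw [curvBound, curvForm, LinearMap.mk₂_apply, abs_le]
  constructor <;> nlinarith only [h1, h2, h3, h4, h5, h6]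

lemma abs_curv_le (a u : E) : |J.curv a u| ≤ J.curvBound * ‖u‖ ^ 2 * ‖a‖ ^ 2 := by
  rw [sq ‖a‖]
  exact J.abs_curvForm_le u a a

lemma abs_curv_div_le (a u : E) :
    |J.curv a u / (6 * ‖a‖)| ≤ J.curvBound * ‖u‖ ^ 2 * ‖a‖ / 6 := by
  rcases eq_or_ne a 0 with rfl | ha
  · simp
  · have hpos : 0 < 6 * ‖a‖ := by positivity
    rw [abs_div, abs_of_pos hpos, div_le_div_iff₀ hpos (by norm_num)]
    linarith [J.abs_curv_le a u]

/-- The potential of an approximate calibration of the segments in the direction `e`: its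
increments along such segments are their lengths up to higher order terms, while its differential
has almost norm one. -/
def calibration (e z : E) : ℝ := ⟪e, z⟫ - 1 / 6 * (⟪e, z⟫ * J.curv e z)

lemma contDiff_calibration (e : E) : ContDiff ℝ 1 (J.calibration e) := by
  have hchristoffel : ContDiff ℝ 1 fun z ↦ J.christoffel e z := by fun_prop
  have hchristoffel' : ContDiff ℝ 1 fun z ↦ J.christoffel z z := by fun_prop
  have hcurv : ContDiff ℝ 1 fun z ↦ J.curv e z := by
    simp only [curv_eq]
    exact (ContDiff.add (by fun_prop) (hchristoffel.inner ℝ hchristoffel)).sub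
      (contDiff_const.inner ℝ hchristoffel')
  have hinner : ContDiff ℝ 1 fun z : E ↦ ⟪e, z⟫ := contDiff_const.inner ℝ contDiff_id
  exact hinner.sub (contDiff_const.mul (hinner.mul hcurv))

lemma fderiv_calibration (e z a : E) : fderiv ℝ (J.calibration e) z a =
    ⟪e, a⟫ - 1 / 6 * (⟪e, a⟫ * J.curv e z + ⟪e, z⟫ * (2 * J.curvForm e z a)) := by
  have hdiff : HasFDerivAt (J.calibration e) (fderiv ℝ (J.calibration e) z) (z + (0 : ℝ) • a) := by
    simpa using ((J.contDiff_calibration e).differentiable one_ne_zero z).hasFDerivAt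
  have hline : HasDerivAt (fun t : ℝ ↦ z + t • a) a 0 := by
    simpa using ((hasDerivAt_id (0 : ℝ)).smul_const a).const_add z
  have hpoly : J.calibration e ∘ (fun t : ℝ ↦ z + t • a) = fun t ↦ (⟪e, z⟫ + t * ⟪e, a⟫)
      - 1 / 6 * ((⟪e, z⟫ + t * ⟪e, a⟫) *
        (J.curv e z + t * (2 * J.curvForm e z a) + t ^ 2 * J.curv e a)) := by
    funext t
    rw [Function.comp_apply, calibration, inner_add_right, real_inner_smul_right,
      J.curv_symm e (z + t • a), curv_add_left, map_smul, curv_smul_left, J.curv_symm z,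
      J.curv_symm a, smul_eq_mul]
    ring
  have hl : HasDerivAt (fun t : ℝ ↦ ⟪e, z⟫ + t * ⟪e, a⟫) ⟪e, a⟫ 0 := by
    simpa using ((hasDerivAt_id (0 : ℝ)).mul_const ⟪e, a⟫).const_add ⟪e, z⟫
  have hq : HasDerivAt (fun t : ℝ ↦ J.curv e z + t * (2 * J.curvForm e z a) + t ^ 2 * J.curv e a)
      (2 * J.curvForm e z a) 0 := by
    exact ((((hasDerivAt_id (0 : ℝ)).mul_const (2 * J.curvForm e z a)).const_add
      (J.curv e z)).add ((hasDerivAt_pow 2 (0 : ℝ)).mul_const (J.curv e a))).congr_deriv (by simp)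
  have hcomp := hdiff.comp_hasDerivAt 0 hline
  rw [hpoly] at hcomp
  rw [hcomp.unique (hl.sub ((hl.mul hq).const_mul (1 / 6)))]
  simp

lemma calibration_add_smul_sub {e : E} (he : ‖e‖ = 1) (u : E) (t : ℝ) :
    J.calibration e (u + t • e) - J.calibration e u = t - 1 / 6 * (t * J.curv e u) := by
  rw [calibration, calibration, curv_add_smul, inner_add_right, real_inner_smul_right,
    real_inner_self_eq_norm_sq, he]
  ring

end Bounds

end MetricJet

section QuadraticBounds

variable {s b K B Kb T y d H : ℝ}

lemma half_mul_le_of_quadratic_bounds (hb : 0 ≤ b) (hK : |K| ≤ y) (hB : |B| ≤ y * b)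
    (hKb : |Kb| ≤ y * b ^ 2) (hy : y ≤ 1 / 10) (hd : d ≤ 1 / 10)
    (hH : s ^ 2 + b ^ 2 - 1 / 3 * (s ^ 2 * K + 2 * (s * B) + Kb) - d * (s ^ 2 + b ^ 2) ≤ H) :
    1 / 2 * (s ^ 2 + b ^ 2) ≤ H := by
  have hsK : s ^ 2 * K ≤ 1 / 10 * s ^ 2 := by
    nlinarith only [le_of_abs_le (hK.trans hy), sq_nonneg s]
  have hsB : |s * B| ≤ 1 / 10 * (|s| * b) := by
    rw [abs_mul, mul_left_comm]
    gcongr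
    exact hB.trans (by gcongr)
  have hKb' : Kb ≤ 1 / 10 * b ^ 2 := (le_of_abs_le hKb).trans (by gcongr)
  have hd' : d * (s ^ 2 + b ^ 2) ≤ 1 / 10 * (s ^ 2 + b ^ 2) := by gcongr
  linarith [le_of_abs_le hsB, two_mul_le_add_sq |s| b, sq_abs s, sq_nonneg s, sq_nonneg b]

lemma sq_le_add_of_quadratic_bounds (hb : 0 ≤ b) (hK : |K| ≤ y) (hB : |B| ≤ y * b)
    (hKb : |Kb| ≤ y * b ^ 2) (hT : |T| ≤ y * b) (hy : y ≤ 1 / 10) (hd : d ≤ 1 / 10)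
    (hyd : 10 * y ^ 2 ≤ d)
    (hH : s ^ 2 + b ^ 2 - 1 / 3 * (s ^ 2 * K + 2 * (s * B) + Kb) - d * (s ^ 2 + b ^ 2) ≤ H) :
    (s * (1 - 1 / 6 * K) - 1 / 3 * T) ^ 2 ≤ H + 3 / 2 * d * s ^ 2 := by
  have hsB : |s * B| ≤ y * |s| * b := by
    rw [abs_mul, mul_comm y, mul_assoc]
    gcongr
  have hsT : |s * T| ≤ y * |s| * b := by
    rw [abs_mul, mul_comm y, mul_assoc]
    gcongr
  have hsKT : |K * (s * T)| ≤ 1 / 10 * (y * |s| * b) := by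
    rw [abs_mul]
    gcongr
    exact hK.trans hy
  have hsK : (s * K) ^ 2 ≤ (y * |s|) ^ 2 := by
    rw [sq_le_sq, abs_mul, abs_mul, abs_abs, mul_comm]
    exact mul_le_mul_of_nonneg_right (hK.trans (le_abs_self y)) (abs_nonneg s)
  have hT2 : T ^ 2 ≤ (1 / 10 * b) ^ 2 :=
    sq_le_sq.2 ((hT.trans (by gcongr)).trans (le_abs_self _))
  have hKb' : Kb ≤ 1 / 10 * b ^ 2 := (le_of_abs_le hKb).trans (by gcongr)
  have hdb : d * b ^ 2 ≤ 1 / 10 * b ^ 2 := by gcongr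
  have hds : 10 * (y * |s|) ^ 2 ≤ d * s ^ 2 := by
    rw [mul_pow, sq_abs, ← mul_assoc]
    gcongr
  have hexp : (s * (1 - 1 / 6 * K) - 1 / 3 * T) ^ 2 = s ^ 2 - 1 / 3 * (s ^ 2 * K)
      + 1 / 36 * (s * K) ^ 2 - 2 / 3 * (s * T) + 1 / 9 * (K * (s * T)) + 1 / 9 * T ^ 2 := by
    ring
  rw [hexp]
  linarith [le_of_abs_le hsB, neg_le_of_abs_le hsT, le_of_abs_le hsKT,
    two_mul_le_add_sq (y * |s|) b, sq_nonneg b, sq_nonneg (y * |s|)]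

lemma sq_le_mul_of_quadratic_bounds (hb : 0 ≤ b) (hK : |K| ≤ y) (hB : |B| ≤ y * b)
    (hKb : |Kb| ≤ y * b ^ 2) (hT : |T| ≤ y * b) (hy : y ≤ 1 / 10) (hd : d ≤ 1 / 10)
    (hyd : 10 * y ^ 2 ≤ d)
    (hH : s ^ 2 + b ^ 2 - 1 / 3 * (s ^ 2 * K + 2 * (s * B) + Kb) - d * (s ^ 2 + b ^ 2) ≤ H) :
    (s * (1 - 1 / 6 * K) - 1 / 3 * T) ^ 2 ≤ (1 + 3 * d) * H := by
  have hd0 : 0 ≤ d := le_trans (by positivity) hyd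
  have hhalf : d * s ^ 2 ≤ d * (2 * H) := by
    gcongr
    linarith [half_mul_le_of_quadratic_bounds hb hK hB hKb hy hd hH, sq_nonneg b]
  linarith [sq_le_add_of_quadratic_bounds hb hK hB hKb hT hy hd hyd hH]

end QuadraticBounds

namespace MetricJet

variable {E : Type*} [NormedAddCommGroup E] [InnerProductSpace ℝ E] [CompleteSpace E]
  (J : MetricJet E)

lemma sq_fderiv_calibration_le {d h : ℝ} {e z a : E} (he : ‖e‖ = 1)
    (hz : J.curvBound * ‖z‖ ^ 2 ≤ 1 / 10) (hd : d ≤ 1 / 10)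
    (hzd : 10 * (J.curvBound * ‖z‖ ^ 2) ^ 2 ≤ d)
    (hh : |h - (‖a‖ ^ 2 - 1 / 3 * J.curv a z)| ≤ d * ‖a‖ ^ 2) :
    (fderiv ℝ (J.calibration e) z a) ^ 2 ≤ (1 + 3 * d) * h := by
  obtain ⟨s, b, rfl, heb⟩ : ∃ (s : ℝ) (b : E), a = s • e + b ∧ ⟪e, b⟫ = 0 :=
    ⟨⟪e, a⟫, a - ⟪e, a⟫ • e, by abel, by
      rw [inner_sub_right, real_inner_smul_right, real_inner_self_eq_norm_sq, he]; ring⟩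
  have hnorm : ‖s • e + b‖ ^ 2 = s ^ 2 + ‖b‖ ^ 2 := by
    rw [norm_add_sq_real, real_inner_smul_left, heb, norm_smul, he, mul_one, Real.norm_eq_abs,
      sq_abs]
    ring
  have hcurv : J.curv (s • e + b) z =
      s ^ 2 * J.curv e z + 2 * (s * J.curvForm z e b) + J.curv b z := by
    rw [curv_add_left, curv_smul_left, map_smul, LinearMap.smul_apply, smul_eq_mul]
  have hder : fderiv ℝ (J.calibration e) z (s • e + b) =
      s * (1 - 1 / 6 * J.curv e z) - 1 / 3 * (⟪e, z⟫ * J.curvForm e z b) := by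
    rw [fderiv_calibration, map_add, map_smul, curvForm_self_right, inner_add_right,
      real_inner_smul_right, real_inner_self_eq_norm_sq, he, heb, smul_eq_mul]
    ring
  rw [hder]
  refine sq_le_mul_of_quadratic_bounds (norm_nonneg b) (B := J.curvForm z e b) (Kb := J.curv b z)
    ?_ ?_ (J.abs_curv_le b z) ?_ hz hd hzd ?_
  · simpa [he] using J.abs_curv_le e z
  · simpa [he] using J.abs_curvForm_le z e b
  · calc |⟪e, z⟫ * J.curvForm e z b| ≤ (1 * ‖z‖) * (J.curvBound * 1 ^ 2 * (‖z‖ * ‖b‖)) := by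
          rw [abs_mul, ← he]
          exact mul_le_mul (abs_real_inner_le_norm e z) (J.abs_curvForm_le e z b) (abs_nonneg _)
            (by positivity)
      _ = J.curvBound * ‖z‖ ^ 2 * ‖b‖ := by ring
  · rw [← hcurv, ← hnorm]
    linarith [neg_le_of_abs_le hh]

lemma eventually_abs_fderiv_calibration_le {δ : ℝ} (hδ : 0 < δ) :
    ∀ᶠ z in 𝓝 (0 : E), ∀ e, ‖e‖ = 1 → ∀ (a : E) (h : ℝ),
      |h - (‖a‖ ^ 2 - 1 / 3 * J.curv a z)| ≤ δ * ‖z‖ ^ 2 * ‖a‖ ^ 2 →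
        |fderiv ℝ (J.calibration e) z a| ≤ (1 + 2 * δ * ‖z‖ ^ 2) * √h := by
  have hsmall (c : ℝ) {d : ℝ} (hd : 0 < d) : ∀ᶠ z in 𝓝 (0 : E), c * ‖z‖ ^ 2 < d := by
    have hcont : Continuous fun z : E ↦ c * ‖z‖ ^ 2 := by fun_prop
    exact hcont.continuousAt.eventually_lt_const (by simpa using hd)
  filter_upwards [hsmall J.curvBound (by norm_num : (0 : ℝ) < 1 / 10),
    hsmall δ (by norm_num : (0 : ℝ) < 1 / 10), hsmall (10 * J.curvBound ^ 2) hδ]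
    with z hz hδz hCz e he a h hh
  have hzd : 10 * (J.curvBound * ‖z‖ ^ 2) ^ 2 ≤ δ * ‖z‖ ^ 2 := by
    nlinarith only [hCz, sq_nonneg ‖z‖]
  have hsq := J.sq_fderiv_calibration_le he hz.le hδz.le hzd hh
  have hd : 0 ≤ δ * ‖z‖ ^ 2 := by positivity
  have hh0 : 0 ≤ h :=
    nonneg_of_mul_nonneg_right ((sq_nonneg _).trans hsq) (by positivity)
  refine abs_le_of_sq_le_sq ?_ (by positivity)
  rw [mul_pow, Real.sq_sqrt hh0]
  refine hsq.trans (mul_le_mul_of_nonneg_right ?_ hh0)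
  nlinarith only [hd]

end MetricJet

namespace MetricJet

variable {E : Type*} [NormedAddCommGroup E] [InnerProductSpace ℝ E] [CompleteSpace E]
  (J : MetricJet E)

/-- The second order approximation of the Riemannian distance in normal coordinates. It is zero
for `u = v`. -/
def approxDist (u v : E) : ℝ := ‖v - u‖ - J.curv (v - u) u / (6 * ‖v - u‖)

lemma abs_approxDist_sub_norm_le {u : E} (hu : J.curvBound * ‖u‖ ^ 2 ≤ 1) (v : E) :
    |J.approxDist u v - ‖v - u‖| ≤ ‖v - u‖ / 6 := by
  rw [approxDist, sub_sub_cancel_left, abs_neg]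
  refine (J.abs_curv_div_le _ _).trans ?_
  gcongr
  exact mul_le_of_le_one_left (norm_nonneg _) hu

lemma approxDist_nonneg {u : E} (hu : J.curvBound * ‖u‖ ^ 2 ≤ 1) (v : E) :
    0 ≤ J.approxDist u v := by
  linarith [neg_le_of_abs_le (J.abs_approxDist_sub_norm_le hu v), norm_nonneg (v - u)]

lemma add_le_sq_approxDist_add (u v : E) {ε : ℝ} (hε : 0 ≤ ε) :
    ‖v - u‖ ^ 2 - 1 / 3 * J.curv (v - u) u + ε * ‖v - u‖ ^ 2 ≤
      (J.approxDist u v + ε * ‖v - u‖) ^ 2 := by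
  rw [approxDist]
  generalize v - u = w
  have hcurv : ‖w‖ * (J.curv w u / (6 * ‖w‖)) = J.curv w u / 6 := by
    rcases eq_or_ne w 0 with rfl | hw
    · simp [curv]
    · field_simp
  nlinarith only [hcurv, sq_nonneg (J.curv w u / (6 * ‖w‖) - ε * ‖w‖),
    mul_nonneg hε (sq_nonneg ‖w‖)]

lemma calibration_sub_eq_approxDist {u v : E} (huv : u ≠ v) :
    J.calibration (‖v - u‖⁻¹ • (v - u)) v - J.calibration (‖v - u‖⁻¹ • (v - u)) u =
      J.approxDist u v := by
  have hw : 0 < ‖v - u‖ := norm_pos_iff.2 (sub_ne_zero.2 huv.symm)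
  have hv : v = u + ‖v - u‖ • (‖v - u‖⁻¹ • (v - u)) := by
    rw [smul_inv_smul₀ hw.ne', add_sub_cancel]
  have he : ‖‖v - u‖⁻¹ • (v - u)‖ = 1 := norm_smul_inv_norm (𝕜 := ℝ) (norm_pos_iff.1 hw)
  have h := J.calibration_add_smul_sub he u ‖v - u‖
  rw [← hv, curv_smul_left] at h
  rw [h, approxDist]
  field_simp

end MetricJet

section Small

lemma eventually_mul_sq_le (c : ℝ) {d : ℝ} (hd : 0 < d) :
    ∀ᶠ ρ in 𝓝[>] (0 : ℝ), c * ρ ^ 2 ≤ d := by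
  have hcont : Continuous fun ρ : ℝ ↦ c * ρ ^ 2 := by fun_prop
  exact nhdsWithin_le_nhds <|
    (hcont.continuousAt.eventually_lt_const (by simpa using hd)).mono fun _ ↦ le_of_lt

lemma eventually_mul_lt (c : ℝ) {d : ℝ} (hd : 0 < d) : ∀ᶠ ρ in 𝓝[>] (0 : ℝ), c * ρ < d :=
  nhdsWithin_le_nhds <|
    (continuous_const_mul c).continuousAt.eventually_lt_const (by simpa using hd)

lemma eventually_forall_norm_le {E : Type*} [NormedAddCommGroup E] {P : E → Prop}
    (hP : ∀ᶠ z in 𝓝 (0 : E), P z) (c : ℝ) :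
    ∀ᶠ ρ in 𝓝[>] (0 : ℝ), ∀ z, ‖z‖ ≤ c * ρ → P z := by
  obtain ⟨r, hr, h⟩ := Metric.eventually_nhds_iff.1 hP
  filter_upwards [eventually_mul_lt c hr] with ρ hρ z hz
  exact h (by rw [dist_zero_right]; exact hz.trans_lt hρ)

end Small

/-- Coordinates around `x` in which the metric, given by the quadratic forms `form`, is the inner
product up to a curvature term, together with the comparison of the metric with the distance: the
distance is at most the length of a segment, and a function whose differential has norm at most `B`
is `B`-Lipschitz. -/
structure NormalChart {M : Type*} [PseudoEMetricSpace M] (x : M) (E : Type*)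
    [NormedAddCommGroup E] [InnerProductSpace ℝ E] [CompleteSpace E] where
  /-- the jet of the metric -/
  jet : MetricJet E
  /-- the parametrization -/
  toFun : E → M
  /-- the coordinates -/
  inv : M → E
  /-- the metric in these coordinates -/
  form : E → E → ℝ
  /-- the radius of the ball on which the parametrization is defined -/
  innerRadius : ℝ
  /-- the radius of the ball on which the coordinates are defined -/
  outerRadius : ℝ
  innerRadius_pos : 0 < innerRadius
  outerRadius_pos : 0 < outerRadius
  map_zero : toFun 0 = x
  norm_inv_lt : ∀ p ∈ Metric.eball x (ENNReal.ofReal outerRadius), ‖inv p‖ < innerRadius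
  right_inv : ∀ p ∈ Metric.eball x (ENNReal.ofReal outerRadius), toFun (inv p) = p
  left_inv : ∀ u, ‖u‖ < innerRadius → inv (toFun u) = u
  expansion : ∀ δ > 0, ∀ᶠ z in 𝓝 (0 : E), ∀ a,
    |form z a - (‖a‖ ^ 2 - 1 / 3 * jet.curv a z)| ≤ δ * ‖z‖ ^ 2 * ‖a‖ ^ 2
  half_le_form : ∀ z, ‖z‖ < innerRadius → ∀ a, 1 / 2 * ‖a‖ ^ 2 ≤ form z a
  edist_le : ∀ u v, ‖u‖ < innerRadius → ‖v‖ < innerRadius → ∀ B : ℝ, 0 ≤ B →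
    (∀ t ∈ Icc (0 : ℝ) 1, form (u + t • (v - u)) (v - u) ≤ B ^ 2) →
      edist (toFun u) (toFun v) ≤ ENNReal.ofReal B
  le_edist : ∀ (p q : M) (S : ℝ≥0∞) (F : E → ℝ) (B : ℝ), 0 ≤ B → ContDiff ℝ 1 F →
    Metric.eball p S ⊆ Metric.eball x (ENNReal.ofReal outerRadius) →
    (∀ z ∈ Metric.eball p S, ∀ a, |fderiv ℝ F (inv z) a| ≤ B * √(form (inv z) a)) →
    edist p q < S → ENNReal.ofReal |F (inv q) - F (inv p)| ≤ ENNReal.ofReal B * edist p q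

namespace NormalChart

variable {M : Type*} [PseudoEMetricSpace M] {x : M} {E : Type*}
  [NormedAddCommGroup E] [InnerProductSpace ℝ E] [CompleteSpace E] (N : NormalChart x E)

lemma inv_self : N.inv x = 0 := by
  have h := N.left_inv 0 (by simpa using N.innerRadius_pos)
  rwa [N.map_zero] at h

lemma norm_le_two_mul_sqrt_form {z : E} (hz : ‖z‖ < N.innerRadius) (a : E) :
    ‖a‖ ≤ 2 * √(N.form z a) := by
  suffices h : ‖a‖ / 2 ≤ √(N.form z a) by linarith
  exact Real.le_sqrt_of_sq_le (by linarith [N.half_le_form z hz a, sq_nonneg ‖a‖])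

lemma norm_inv_le {p : M} (hp : edist x p < ENNReal.ofReal N.outerRadius) :
    ‖N.inv p‖ ≤ 2 * (edist x p).toReal := by
  rcases eq_or_ne (N.inv p) 0 with h0 | h0
  · rw [h0, norm_zero]
    positivity
  have hsq : ENNReal.ofReal (‖N.inv p‖ ^ 2) ≤ ENNReal.ofReal (2 * ‖N.inv p‖) * edist x p := by
    have h := N.le_edist x p (ENNReal.ofReal N.outerRadius) (innerSL ℝ (N.inv p))
      (2 * ‖N.inv p‖) (by positivity) (innerSL ℝ (N.inv p)).contDiff subset_rfl
      (fun z hz a ↦ ?_) hp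
    · simpa [N.inv_self] using h
    · rw [ContinuousLinearMap.fderiv, innerSL_apply_apply]
      calc |⟪N.inv p, a⟫| ≤ ‖N.inv p‖ * ‖a‖ := abs_real_inner_le_norm _ _
        _ ≤ ‖N.inv p‖ * (2 * √(N.form (N.inv z) a)) := by
          gcongr
          exact N.norm_le_two_mul_sqrt_form (N.norm_inv_lt z hz) a
        _ = 2 * ‖N.inv p‖ * √(N.form (N.inv z) a) := by ring
  have hfin : edist x p ≠ ⊤ := (hp.trans ENNReal.ofReal_lt_top).ne
  have h := ENNReal.toReal_mono (ENNReal.mul_ne_top ENNReal.ofReal_ne_top hfin) hsq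
  rw [ENNReal.toReal_ofReal (sq_nonneg _), ENNReal.toReal_mul,
    ENNReal.toReal_ofReal (by positivity)] at h
  exact le_of_mul_le_mul_left (by linarith) (norm_pos_iff.2 h0)

lemma edist_le_approxDist_add {δ : ℝ} (hδ : 0 < δ) : ∀ᶠ ρ in 𝓝[>] (0 : ℝ), ∀ u v,
    ‖u‖ ≤ ρ → ‖v‖ ≤ ρ → edist (N.toFun u) (N.toFun v) ≤
      ENNReal.ofReal (N.jet.approxDist u v + δ * ρ ^ 2 * ‖v - u‖) := by
  filter_upwards [eventually_forall_norm_le (N.expansion δ hδ) 1,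
    eventually_mul_lt 1 N.innerRadius_pos, eventually_mul_sq_le N.jet.curvBound one_pos,
    self_mem_nhdsWithin] with ρ hexp hr hC hρ u v hu hv
  rw [one_mul] at hr hexp
  have hCu : N.jet.curvBound * ‖u‖ ^ 2 ≤ 1 := hC.trans' <| by
    gcongr
    exact N.jet.curvBound_nonneg
  refine N.edist_le u v (hu.trans_lt hr) (hv.trans_lt hr) _
    (add_nonneg (N.jet.approxDist_nonneg hCu v) (by positivity)) fun t ht ↦ ?_
  have hseg : ‖u + t • (v - u)‖ ≤ ρ := mem_closedBall_zero_iff.1 <|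
    (convex_closedBall (0 : E) ρ).add_smul_sub_mem (mem_closedBall_zero_iff.2 hu)
      (mem_closedBall_zero_iff.2 hv) ht
  have hform := le_of_abs_le (hexp _ hseg (v - u))
  rw [N.jet.curv_add_smul, sub_le_iff_le_add'] at hform
  refine (hform.trans ?_).trans (N.jet.add_le_sq_approxDist_add u v (by positivity))
  gcongr

lemma edist_le_two_mul : ∀ᶠ ρ in 𝓝[>] (0 : ℝ), ∀ u v, ‖u‖ ≤ ρ → ‖v‖ ≤ ρ →
    edist (N.toFun u) (N.toFun v) ≤ ENNReal.ofReal (2 * ‖v - u‖) := by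
  filter_upwards [N.edist_le_approxDist_add one_pos,
    eventually_mul_sq_le N.jet.curvBound one_pos,
    eventually_mul_sq_le 1 (by norm_num : (0 : ℝ) < 1 / 2)] with ρ hup hC hρ u v hu hv
  refine (hup u v hu hv).trans (ENNReal.ofReal_le_ofReal ?_)
  have hCu : N.jet.curvBound * ‖u‖ ^ 2 ≤ 1 := hC.trans' <| by
    gcongr
    exact N.jet.curvBound_nonneg
  linarith [le_of_abs_le (N.jet.abs_approxDist_sub_norm_le hCu v), norm_nonneg (v - u),
    mul_le_mul_of_nonneg_right hρ (norm_nonneg (v - u))]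

lemma eventually_eball_subset : ∀ᶠ ρ in 𝓝[>] (0 : ℝ), ∀ u, ‖u‖ ≤ ρ →
    ∀ p ∈ Metric.eball (N.toFun u) (ENNReal.ofReal (5 * ρ)),
      p ∈ Metric.eball x (ENNReal.ofReal N.outerRadius) ∧ ‖N.inv p‖ ≤ 14 * ρ := by
  filter_upwards [N.edist_le_two_mul, eventually_mul_lt 7 N.outerRadius_pos,
    self_mem_nhdsWithin] with ρ hcoarse hR hρ u hu p hp
  have hρ0 : 0 ≤ ρ := le_of_lt hρ
  have hxu : edist x (N.toFun u) ≤ ENNReal.ofReal (2 * ρ) := by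
    have h := hcoarse 0 u (by rwa [norm_zero]) hu
    rw [N.map_zero, sub_zero] at h
    exact h.trans (ENNReal.ofReal_le_ofReal (by linarith))
  have hxp : edist x p ≤ ENNReal.ofReal (7 * ρ) :=
    calc edist x p ≤ edist x (N.toFun u) + edist (N.toFun u) p := edist_triangle _ _ _
      _ ≤ ENNReal.ofReal (2 * ρ) + ENNReal.ofReal (5 * ρ) := by
        gcongr
        rw [edist_comm]
        exact hp.le
      _ = ENNReal.ofReal (7 * ρ) := by
        rw [← ENNReal.ofReal_add (by positivity) (by positivity)]
        congr 1
        ring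
  have hxp' : edist x p < ENNReal.ofReal N.outerRadius :=
    hxp.trans_lt ((ENNReal.ofReal_lt_ofReal_iff N.outerRadius_pos).2 hR)
  refine ⟨by rwa [Metric.mem_eball, edist_comm], ?_⟩
  linarith [N.norm_inv_le hxp', ENNReal.toReal_le_of_le_ofReal (by positivity) hxp]

lemma approxDist_le_mul_edist {δ : ℝ} (hδ : 0 < δ) : ∀ᶠ ρ in 𝓝[>] (0 : ℝ), ∀ u v,
    ‖u‖ ≤ ρ → ‖v‖ ≤ ρ → ENNReal.ofReal |N.jet.approxDist u v| ≤
      ENNReal.ofReal (1 + δ * ρ ^ 2) * edist (N.toFun u) (N.toFun v) := by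
  have hδ' : 0 < δ / 392 := by positivity
  filter_upwards [N.edist_le_two_mul, N.eventually_eball_subset,
    eventually_forall_norm_le ((N.expansion (δ / 392) hδ').and
      (N.jet.eventually_abs_fderiv_calibration_le hδ')) 14,
    eventually_mul_lt 1 N.innerRadius_pos, self_mem_nhdsWithin]
    with ρ hcoarse hball hexp hr hρ u v hu hv
  have hρ : 0 < ρ := hρ
  rw [one_mul] at hr
  rcases eq_or_ne u v with rfl | huv
  · simp [MetricJet.approxDist]
  have he : ‖‖v - u‖⁻¹ • (v - u)‖ = 1 :=
    norm_smul_inv_norm (𝕜 := ℝ) (sub_ne_zero.2 huv.symm)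
  have h := N.le_edist (N.toFun u) (N.toFun v) (ENNReal.ofReal (5 * ρ))
    (N.jet.calibration (‖v - u‖⁻¹ • (v - u))) (1 + δ * ρ ^ 2) (by positivity)
    (N.jet.contDiff_calibration _) (fun p hp ↦ (hball u hu p hp).1) (fun p hp a ↦ ?_) ?_
  · rwa [N.left_inv u (hu.trans_lt hr), N.left_inv v (hv.trans_lt hr),
      N.jet.calibration_sub_eq_approxDist huv] at h
  · have hp14 := (hball u hu p hp).2
    obtain ⟨hform, hcal⟩ := hexp _ hp14
    refine (hcal _ he a _ (hform a)).trans ?_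
    have hsq : 2 * (δ / 392) * ‖N.inv p‖ ^ 2 ≤ 2 * (δ / 392) * (14 * ρ) ^ 2 := by gcongr
    refine mul_le_mul_of_nonneg_right ?_ (Real.sqrt_nonneg _)
    linarith
  · refine (hcoarse u v hu hv).trans_lt ((ENNReal.ofReal_lt_ofReal_iff (by positivity)).2 ?_)
    linarith [norm_sub_le v u]

lemma abs_edist_sub_approxDist_le {δ : ℝ} (hδ : 0 < δ) : ∀ᶠ ρ in 𝓝[>] (0 : ℝ), ∀ u v,
    ‖u‖ ≤ ρ → ‖v‖ ≤ ρ → edist (N.toFun u) (N.toFun v) ≠ ⊤ ∧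
      |(edist (N.toFun u) (N.toFun v)).toReal - N.jet.approxDist u v| ≤
        δ * ρ ^ 2 * ‖v - u‖ := by
  filter_upwards [N.edist_le_approxDist_add hδ, N.edist_le_two_mul,
    N.approxDist_le_mul_edist (half_pos hδ), eventually_mul_sq_le N.jet.curvBound one_pos]
    with ρ hup hcoarse hlow hC u v hu hv
  have hne : edist (N.toFun u) (N.toFun v) ≠ ⊤ := ne_top_of_le_ne_top ENNReal.ofReal_ne_top
    (hup u v hu hv)
  have hCu : N.jet.curvBound * ‖u‖ ^ 2 ≤ 1 := hC.trans' <| by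
    gcongr
    exact N.jet.curvBound_nonneg
  have hlow' := ENNReal.toReal_mono (ENNReal.mul_ne_top ENNReal.ofReal_ne_top hne)
    (hlow u v hu hv)
  rw [ENNReal.toReal_ofReal (abs_nonneg _), ENNReal.toReal_mul,
    ENNReal.toReal_ofReal (by positivity)] at hlow'
  have hcoarse' := ENNReal.toReal_le_of_le_ofReal (by positivity) (hcoarse u v hu hv)
  have hdist : δ / 2 * ρ ^ 2 * (edist (N.toFun u) (N.toFun v)).toReal ≤
      δ / 2 * ρ ^ 2 * (2 * ‖v - u‖) := by gcongr
  have hup' := ENNReal.toReal_le_of_le_ofReal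
    (add_nonneg (N.jet.approxDist_nonneg hCu v) (by positivity)) (hup u v hu hv)
  refine ⟨hne, abs_le.2 ⟨?_, by linarith⟩⟩
  linarith [le_abs_self (N.jet.approxDist u v)]

end NormalChart

namespace MetricJet

variable {E : Type*} [NormedAddCommGroup E] [InnerProductSpace ℝ E] [CompleteSpace E]
  (J : MetricJet E)

lemma eventually_half_mul_sq_norm_le {h : E → E → ℝ} {δ : ℝ} (hh : ∀ᶠ z in 𝓝 (0 : E), ∀ a,
      |h z a - (‖a‖ ^ 2 - 1 / 3 * J.curv a z)| ≤ δ * ‖z‖ ^ 2 * ‖a‖ ^ 2) :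
    ∀ᶠ z in 𝓝 (0 : E), ∀ a, 1 / 2 * ‖a‖ ^ 2 ≤ h z a := by
  have hcont : Continuous fun z : E ↦ (δ + J.curvBound / 3) * ‖z‖ ^ 2 := by fun_prop
  filter_upwards [hh, hcont.continuousAt.eventually_lt_const
    (by simp : (δ + J.curvBound / 3) * ‖(0 : E)‖ ^ 2 < 1 / 2)] with z hz hsmall a
  nlinarith only [neg_le_of_abs_le (hz a), le_of_abs_le (J.abs_curv_le a z),
    mul_le_mul_of_nonneg_right hsmall.le (sq_nonneg ‖a‖)]

section AffineNormalMap

variable {V : Type*} [NormedAddCommGroup V] [NormedSpace ℝ V] (L : E →L[ℝ] V) (y : V)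

/-- The normal coordinates of the jet, read in the affine coordinates `z ↦ y + L z`. -/
def affineNormalMap (z : E) : V := y + L (J.normalMap z)

lemma contDiff_affineNormalMap : ContDiff ℝ ∞ (J.affineNormalMap L y) :=
  contDiff_const.add (L.contDiff.comp J.contDiff_normalMap)

@[simp] lemma affineNormalMap_zero : J.affineNormalMap L y 0 = y := by
  simp [affineNormalMap]

lemma fderiv_affineNormalMap (z : E) :
    fderiv ℝ (J.affineNormalMap L y) z = L ∘L fderiv ℝ J.normalMap z :=
  ((L.hasFDerivAt.comp z
    (J.contDiff_normalMap.differentiable (by simp) z).hasFDerivAt).const_add y).fderiv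

lemma hasFDerivAt_affineNormalMap_zero : HasFDerivAt (J.affineNormalMap L y) L 0 := by
  have h := ((J.contDiff_affineNormalMap L y).differentiable (by simp) 0).hasFDerivAt
  rwa [fderiv_affineNormalMap, fderiv_normalMap_zero, ContinuousLinearMap.comp_id] at h

lemma normalForm_affinePullback_apply (g : V → V →L[ℝ] V →L[ℝ] ℝ) (z a b : E) :
    J.normalForm (affinePullback L g y) z a b = g (J.affineNormalMap L y z)
      (fderiv ℝ (J.affineNormalMap L y) z a) (fderiv ℝ (J.affineNormalMap L y) z b) := by
  rw [fderiv_affineNormalMap]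
  rfl

end AffineNormalMap

end MetricJet

lemma fderiv_apply_fderiv_symm {E V : Type*} [NormedAddCommGroup E] [NormedSpace ℝ E]
    [NormedAddCommGroup V] [NormedSpace ℝ V] (e : OpenPartialHomeomorph E V) {y : V}
    (hy : y ∈ e.target) (he : DifferentiableAt ℝ e (e.symm y))
    (hsymm : DifferentiableAt ℝ e.symm y) (a : V) :
    fderiv ℝ e (e.symm y) (fderiv ℝ e.symm y a) = a := by
  have hid : HasFDerivAt (e ∘ e.symm) (ContinuousLinearMap.id ℝ V) y :=
    (hasFDerivAt_id y).congr_of_eventuallyEq (e.eventually_right_inverse hy)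
  exact DFunLike.congr_fun ((he.hasFDerivAt.comp y hsymm.hasFDerivAt).unique hid) a

namespace RiemannianCoord

variable {n : ℕ} {H : Type*} [TopologicalSpace H]
  (I : ModelWithCorners ℝ (EuclideanSpace ℝ (Fin n)) H)
  {M : Type*}

local notation "𝔼" => EuclideanSpace ℝ (Fin n)

section Chart

variable [PseudoEMetricSpace M] [ChartedSpace H M] {x : M}

lemma exists_radii (hx : I.IsInteriorPoint x) {e : OpenPartialHomeomorph 𝔼 𝔼}
    (h0 : 0 ∈ e.source) (hex : e 0 = extChartAt I x x)
    (hsymm : ContDiffAt ℝ 1 e.symm (extChartAt I x x)) {P : 𝔼 → Prop} (hP : ∀ᶠ z in 𝓝 0, P z) :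
    ∃ r > 0, ∃ R > 0,
      (∀ z, ‖z‖ < r → P z ∧ z ∈ e.source ∧ e z ∈ (extChartAt I x).target) ∧
      ∀ p ∈ Metric.eball x (ENNReal.ofReal R), p ∈ (extChartAt I x).source ∧
        extChartAt I x p ∈ e.target ∧ ContDiffAt ℝ 1 e.symm (extChartAt I x p) ∧
        ‖e.symm (extChartAt I x p)‖ < r := by
  have htarget : ∀ᶠ z in 𝓝 0, e z ∈ (extChartAt I x).target := by
    refine (e.continuousAt h0).eventually_mem ?_
    rw [hex]
    exact extChartAt_target_mem_nhds_of_isInteriorPoint I hx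
  obtain ⟨r, hr, hinner⟩ := Metric.eventually_nhds_iff.1
    (hP.and ((e.open_source.eventually_mem h0).and htarget))
  have hmem : extChartAt I x x ∈ e.target := hex ▸ e.map_source h0
  have hzero : e.symm (extChartAt I x x) = 0 := by rw [← hex, e.left_inv h0]
  have hcoord : ∀ᶠ y in 𝓝 (extChartAt I x x),
      y ∈ e.target ∧ ContDiffAt ℝ 1 e.symm y ∧ ‖e.symm y‖ < r :=
    (e.open_target.eventually_mem hmem).and ((hsymm.eventually (by simp)).and
      (hsymm.continuousAt.norm.eventually_lt_const (by simpa only [hzero, norm_zero] using hr)))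
  obtain ⟨R', hR', houter⟩ := EMetric.mem_nhds_iff.1 <|
    (eventually_mem_set.2 (extChartAt_source_mem_nhds (I := I) x)).and
      ((continuousAt_extChartAt x).eventually hcoord)
  obtain ⟨R, hR, hRR'⟩ := ENNReal.lt_iff_exists_nnreal_btwn.1 hR'
  refine ⟨r, hr, R, by exact_mod_cast hR, fun z hz ↦ hinner (by rwa [dist_zero_right]),
    fun p hp ↦ houter (Metric.eball_subset_eball ?_ hp)⟩
  rw [ENNReal.ofReal_coe_nnreal]
  exact hRR'.le

variable [IsManifold I 1 M] [Bundle.RiemannianBundle (fun x : M ↦ TangentSpace I x)]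
  [IsRiemannianManifold I M]

lemma edist_segment_le (x : M) {Ψ : 𝔼 → 𝔼} (hΨ : ContDiff ℝ 1 Ψ) {u v : 𝔼} {B : ℝ} (hB : 0 ≤ B)
    (htarget : ∀ t ∈ Icc (0 : ℝ) 1, Ψ (u + t • (v - u)) ∈ (extChartAt I x).target)
    (hform : ∀ t ∈ Icc (0 : ℝ) 1, metricForm I x (Ψ (u + t • (v - u)))
      (fderiv ℝ Ψ (u + t • (v - u)) (v - u)) (fderiv ℝ Ψ (u + t • (v - u)) (v - u)) ≤ B ^ 2) :
    edist ((extChartAt I x).symm (Ψ u)) ((extChartAt I x).symm (Ψ v)) ≤ ENNReal.ofReal B := by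
  have hderiv (t : ℝ) : HasDerivAt (fun t : ℝ ↦ Ψ (u + t • (v - u)))
      (fderiv ℝ Ψ (u + t • (v - u)) (v - u)) t := by
    have hline : HasDerivAt (fun t : ℝ ↦ u + t • (v - u)) (v - u) t := by
      simpa using ((hasDerivAt_id t).smul_const (v - u)).const_add u
    exact (hΨ.differentiable one_ne_zero _).hasFDerivAt.comp_hasDerivAt t hline
  have hsmooth : ContDiff ℝ 1 fun t : ℝ ↦ Ψ (u + t • (v - u)) := hΨ.comp (by fun_prop)
  have h := edist_extChartAt_symm_le I x (B := B) hsmooth.contDiffOn htarget fun t ht ↦ ?_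
  · simpa using h
  · rw [(hderiv t).hasDerivWithinAt.derivWithin (uniqueDiffOn_Icc zero_lt_one t ht)]
    exact Real.sqrt_le_iff.2 ⟨hB, hform t ht⟩

lemma ofReal_abs_sub_symm_le (x : M) {e : OpenPartialHomeomorph 𝔼 𝔼} (he : ContDiff ℝ 1 e)
    {p q : M} {S : ℝ≥0∞} {F : 𝔼 → ℝ} {B : ℝ} (hB : 0 ≤ B) (hF : ContDiff ℝ 1 F)
    (hS : ∀ z ∈ Metric.eball p S, z ∈ (extChartAt I x).source ∧ extChartAt I x z ∈ e.target ∧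
      ContDiffAt ℝ 1 e.symm (extChartAt I x z))
    (hFB : ∀ z ∈ Metric.eball p S, ∀ a, |fderiv ℝ F (e.symm (extChartAt I x z)) a| ≤
      B * √(metricForm I x (e (e.symm (extChartAt I x z)))
        (fderiv ℝ e (e.symm (extChartAt I x z)) a) (fderiv ℝ e (e.symm (extChartAt I x z)) a)))
    (hpq : edist p q < S) :
    ENNReal.ofReal |F (e.symm (extChartAt I x q)) - F (e.symm (extChartAt I x p))| ≤
      ENNReal.ofReal B * edist p q := by
  refine ofReal_abs_sub_extChartAt_le I x (f := F ∘ e.symm) hB (fun z hz ↦ (hS z hz).1)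
    (fun z hz ↦ hF.contDiffAt.comp _ (hS z hz).2.2) (fun z hz a ↦ ?_) hpq
  obtain ⟨-, hmem, hsymm⟩ := hS z hz
  have hdiff := hsymm.differentiableAt one_ne_zero
  have h := hFB z hz (fderiv ℝ e.symm (extChartAt I x z) a)
  rw [fderiv_apply_fderiv_symm e hmem (he.differentiable one_ne_zero _) hdiff,
    e.right_inv hmem] at h
  rwa [fderiv_comp _ (hF.differentiable one_ne_zero _) hdiff]

lemma exists_normalChart_of_expansion (hx : I.IsInteriorPoint x)
    {e : OpenPartialHomeomorph 𝔼 𝔼} (he : ContDiff ℝ 1 e) (h0 : 0 ∈ e.source)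
    (hex : e 0 = extChartAt I x x) (hsymm : ContDiffAt ℝ 1 e.symm (extChartAt I x x))
    (J : MetricJet 𝔼) (hexp : ∀ δ > 0, ∀ᶠ z in 𝓝 (0 : 𝔼), ∀ a,
      |metricForm I x (e z) (fderiv ℝ e z a) (fderiv ℝ e z a)
        - (‖a‖ ^ 2 - 1 / 3 * J.curv a z)| ≤ δ * ‖z‖ ^ 2 * ‖a‖ ^ 2) :
    ∃ N : NormalChart x 𝔼, N.jet = J := by
  obtain ⟨r, hr, R, hR, hinner, houter⟩ := exists_radii I hx h0 hex hsymm
    (J.eventually_half_mul_sq_norm_le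
      (h := fun z a ↦ metricForm I x (e z) (fderiv ℝ e z a) (fderiv ℝ e z a)) (hexp 1 one_pos))
  refine ⟨{
    jet := J
    toFun := fun z ↦ (extChartAt I x).symm (e z)
    inv := fun p ↦ e.symm (extChartAt I x p)
    form := fun z a ↦ metricForm I x (e z) (fderiv ℝ e z a) (fderiv ℝ e z a)
    innerRadius := r
    outerRadius := R
    innerRadius_pos := hr
    outerRadius_pos := hR
    map_zero := by rw [hex, extChartAt_to_inv]
    norm_inv_lt := fun p hp ↦ (houter p hp).2.2.2
    right_inv := fun p hp ↦ by
      rw [e.right_inv (houter p hp).2.1, (extChartAt I x).left_inv (houter p hp).1]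
    left_inv := fun u hu ↦ by
      rw [(extChartAt I x).right_inv (hinner u hu).2.2, e.left_inv (hinner u hu).2.1]
    expansion := hexp
    half_le_form := fun z hz ↦ (hinner z hz).1
    edist_le := fun u v hu hv B hB hform ↦ edist_segment_le I x he hB (fun t ht ↦
      have hseg := (convex_ball (0 : 𝔼) r).add_smul_sub_mem (mem_ball_zero_iff.2 hu)
        (mem_ball_zero_iff.2 hv) ht
      (hinner _ (mem_ball_zero_iff.1 hseg)).2.2) hform
    le_edist := fun p q S F B hB hF hS hFB hpq ↦ ofReal_abs_sub_symm_le I x he hB hF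
      (fun z hz ↦ ⟨(houter z (hS hz)).1, (houter z (hS hz)).2.1, (houter z (hS hz)).2.2.1⟩)
      hFB hpq }, rfl⟩

end Chart

variable [PseudoEMetricSpace M] [ChartedSpace H M] [IsManifold I 3 M]
  [Bundle.RiemannianBundle (fun x : M ↦ TangentSpace I x)]
  [IsContMDiffRiemannianBundle I 2 (EuclideanSpace ℝ (Fin n)) (fun x : M ↦ TangentSpace I x)]
  [IsRiemannianManifold I M] {x : M}

lemma exists_normalChart (hx : I.IsInteriorPoint x) : ∃ N : NormalChart x 𝔼,
    N.jet.scal = scalarCurvature I x := by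
  obtain ⟨L, hL, hinv⟩ := exists_orthonormalFrame I x (mem_extChartAt_target (I := I) x)
  set J := frameJet I hx (L : 𝔼 →L[ℝ] 𝔼)
  set Ψ := J.affineNormalMap (L : 𝔼 →L[ℝ] 𝔼) (extChartAt I x x)
  have hΨ : ContDiff ℝ ∞ Ψ := J.contDiff_affineNormalMap _ _
  have hΨ0 : HasFDerivAt Ψ (L : 𝔼 →L[ℝ] 𝔼) 0 := J.hasFDerivAt_affineNormalMap_zero _ _
  have hΨx : Ψ 0 = extChartAt I x x := J.affineNormalMap_zero _ _
  have hsymm := hΨ.contDiffAt.to_localInverse hΨ0 (by simp)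
  rw [hΨx] at hsymm
  have hpull : ContDiffAt ℝ 2 (affinePullback (L : 𝔼 →L[ℝ] 𝔼) (metricForm I x)
      (extChartAt I x x)) 0 :=
    contDiffAt_affinePullback _ (contDiffAt_metricForm I hx)
  have hexp (δ : ℝ) (hδ : 0 < δ) : ∀ᶠ z in 𝓝 (0 : 𝔼), ∀ a,
      |metricForm I x (Ψ z) (fderiv ℝ Ψ z a) (fderiv ℝ Ψ z a)
        - (‖a‖ ^ 2 - 1 / 3 * J.curv a z)| ≤ δ * ‖z‖ ^ 2 * ‖a‖ ^ 2 := by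
    have hone (a b : 𝔼) : affinePullback (L : 𝔼 →L[ℝ] 𝔼) (metricForm I x)
        (extChartAt I x x) 0 a b = ⟪a, b⟫ := by simpa [affinePullback] using hL a b
    filter_upwards [J.normalForm_expansion hpull hone rfl rfl hδ] with z hz a
    simpa only [J.normalForm_affinePullback_apply] using hz a
  obtain ⟨N, hN⟩ := exists_normalChart_of_expansion I hx
    (e := hΨ.contDiffAt.toOpenPartialHomeomorph Ψ hΨ0 (by simp)) (hΨ.of_le (by norm_cast))
    (hΨ.contDiffAt.mem_toOpenPartialHomeomorph_source hΨ0 (by simp)) hΨx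
    (hsymm.of_le (by norm_cast)) J hexp
  exact ⟨N, hN ▸ scal_frameJet I hx hL hinv⟩

end RiemannianCoord

/-! ### Sums of distances in the Euclidean ball -/

lemma sum_sum_eq_two_mul_sum_Ioi {m : ℕ} (f : Fin m → Fin m → ℝ) (hf : ∀ i j, f i j = f j i) :
    ∑ i, ∑ j, f i j = ∑ i, f i i + 2 * ∑ i, ∑ j ∈ Finset.Ioi i, f i j := by
  have hrow (i : Fin m) : ∑ j, f i j = f i i + ∑ j ∈ {i}ᶜ, f j i := by
    rw [← Finset.sum_compl_add_sum {i}, Finset.sum_singleton, add_comm]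
    simp only [hf i]
  simp only [hrow, Finset.sum_add_distrib]
  rw [← Finset.sum_sum_Ioi_add_eq_sum_sum_off_diag]
  simp only [fun i j ↦ hf j i, ← two_mul, ← Finset.mul_sum]

lemma sum_card_Ioi (n : ℕ) :
    ∑ i : Fin (n + 1), ∑ _j ∈ Finset.Ioi i, (1 : ℝ) = n * (n + 1) / 2 := by
  have h := sum_sum_eq_two_mul_sum_Ioi (m := n + 1) (fun _ _ ↦ 1) fun _ _ ↦ rfl
  simp only [Finset.sum_const, Finset.card_univ, Fintype.card_fin, nsmul_eq_mul, mul_one] at h ⊢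
  push_cast at h
  linarith

section SumDist

variable {V : Type*} [NormedAddCommGroup V] {q : ℕ}

/-- The sum of the pairwise distances of finitely many points. -/
def sumDist (u : Fin q → V) : ℝ := ∑ i, ∑ j ∈ Finset.Ioi i, ‖u j - u i‖

lemma sumDist_smul [NormedSpace ℝ V] {t : ℝ} (ht : 0 ≤ t) (u : Fin q → V) :
    sumDist (t • u) = t * sumDist u := by
  simp only [sumDist, Pi.smul_apply, ← smul_sub, norm_smul, Real.norm_of_nonneg ht, Finset.mul_sum]

lemma continuous_sumDist : Continuous (sumDist : (Fin q → V) → ℝ) := by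
  unfold sumDist
  fun_prop

lemma sum_one_sub_norm_sq_nonneg {u : Fin q → V} (hu : ∀ i, ‖u i‖ ≤ 1) :
    0 ≤ ∑ i, (1 - ‖u i‖ ^ 2) :=
  Finset.sum_nonneg fun i _ ↦ sub_nonneg.2 (pow_le_one₀ (norm_nonneg _) (hu i))

end SumDist

/-- The edge length of the regular simplex with `n + 1` vertices inscribed in the unit sphere. -/
def simplexEdge (n : ℕ) : ℝ := √(2 * (n + 1) / n)

/-- The sum of the edge lengths of the regular simplex with `n + 1` vertices inscribed in the unit
sphere. -/
def simplexSum (n : ℕ) : ℝ := n * (n + 1) / 2 * simplexEdge n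

lemma simplexEdge_sq (n : ℕ) : simplexEdge n ^ 2 = 2 * (n + 1) / n :=
  Real.sq_sqrt (by positivity)

lemma mul_simplexEdge_sq {n : ℕ} (hn : 0 < n) : n * simplexEdge n ^ 2 = 2 * (n + 1) := by
  rw [simplexEdge_sq]
  field_simp

lemma simplexEdge_pos {n : ℕ} (hn : 0 < n) : 0 < simplexEdge n := by
  unfold simplexEdge
  positivity

lemma simplexSum_pos {n : ℕ} (hn : 0 < n) : 0 < simplexSum n := by
  have := simplexEdge_pos hn
  unfold simplexSum
  positivity

section Maximum

variable {V : Type*} [NormedAddCommGroup V] [InnerProductSpace ℝ V] {n : ℕ}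

lemma sum_norm_sub_sq (u : Fin (n + 1) → V) :
    ∑ i, ∑ j ∈ Finset.Ioi i, ‖u j - u i‖ ^ 2 = (n + 1) * ∑ i, ‖u i‖ ^ 2 - ‖∑ i, u i‖ ^ 2 := by
  have hpairs := sum_sum_eq_two_mul_sum_Ioi (fun i j ↦ ‖u j - u i‖ ^ 2) fun i j ↦ by
    rw [norm_sub_rev]
  have hsum : ‖∑ i, u i‖ ^ 2 = ∑ i, ∑ j, ⟪u j, u i⟫ := by
    rw [← real_inner_self_eq_norm_sq, inner_sum]
    simp only [sum_inner]
  simp only [sub_self, norm_zero, zero_pow two_ne_zero, Finset.sum_const_zero, zero_add,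
    norm_sub_sq_real, Finset.sum_add_distrib, Finset.sum_sub_distrib, ← Finset.mul_sum, ← hsum,
    Finset.sum_const, Finset.card_univ, Fintype.card_fin, nsmul_eq_mul] at hpairs ⊢
  push_cast at hpairs
  linarith

lemma simplexSum_sub_sumDist (hn : 0 < n) (u : Fin (n + 1) → V) :
    2 * simplexEdge n * (simplexSum n - sumDist u) =
      ∑ i, ∑ j ∈ Finset.Ioi i, (‖u j - u i‖ - simplexEdge n) ^ 2 +
        ((n + 1) * ∑ i, (1 - ‖u i‖ ^ 2) + ‖∑ i, u i‖ ^ 2) := by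
  have hdefect : ∑ i, ∑ j ∈ Finset.Ioi i, (‖u j - u i‖ - simplexEdge n) ^ 2 =
      ∑ i, ∑ j ∈ Finset.Ioi i, ‖u j - u i‖ ^ 2 - 2 * simplexEdge n * sumDist u +
        simplexEdge n ^ 2 * ∑ i : Fin (n + 1), ∑ _j ∈ Finset.Ioi i, (1 : ℝ) := by
    simp only [sumDist, Finset.mul_sum, ← Finset.sum_sub_distrib, ← Finset.sum_add_distrib]
    exact Finset.sum_congr rfl fun i _ ↦ Finset.sum_congr rfl fun j _ ↦ by ring
  rw [hdefect, sum_norm_sub_sq, sum_card_Ioi, simplexSum]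
  simp only [Finset.sum_sub_distrib, Finset.sum_const, Finset.card_univ, Fintype.card_fin,
    nsmul_eq_mul]
  push_cast
  linear_combination (n + 1) / 2 * mul_simplexEdge_sq hn

lemma sumDist_le_of_norm_le_one (hn : 0 < n) {u : Fin (n + 1) → V} (hu : ∀ i, ‖u i‖ ≤ 1) :
    sumDist u ≤ simplexSum n := by
  have hedge := simplexEdge_pos hn
  have hnonneg : 0 ≤ 2 * simplexEdge n * (simplexSum n - sumDist u) := by
    have := sum_one_sub_norm_sq_nonneg hu
    rw [simplexSum_sub_sumDist hn]
    positivity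
  exact sub_nonneg.1 (nonneg_of_mul_nonneg_right hnonneg (by positivity))

lemma sumDist_le (hn : 0 < n) {r : ℝ} (hr : 0 < r) {u : Fin (n + 1) → V} (hu : ∀ i, ‖u i‖ ≤ r) :
    sumDist u ≤ r * simplexSum n := by
  have h := sumDist_le_of_norm_le_one hn (u := r⁻¹ • u) fun i ↦ by
    rw [Pi.smul_apply, norm_smul, norm_inv, Real.norm_of_nonneg hr.le, inv_mul_le_one₀ hr]
    exact hu i
  rwa [sumDist_smul (inv_nonneg.2 hr.le), inv_mul_le_iff₀ hr] at h

/-- The vertices of a regular simplex inscribed in the unit sphere. -/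
def IsRegularSimplex (u : Fin (n + 1) → V) : Prop :=
  ∀ i j, ⟪u i, u j⟫ = if i = j then 1 else -1 / (n : ℝ)

namespace IsRegularSimplex

variable {u : Fin (n + 1) → V}

lemma norm_eq_one (h : IsRegularSimplex u) (i : Fin (n + 1)) : ‖u i‖ = 1 := by
  have hi := h i i
  rw [if_pos rfl, real_inner_self_eq_norm_sq] at hi
  exact (pow_eq_one_iff_of_nonneg (norm_nonneg _) two_ne_zero).1 hi

lemma norm_sub_eq (hn : 0 < n) (h : IsRegularSimplex u) {i j : Fin (n + 1)} (hij : i ≠ j) :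
    ‖u j - u i‖ = simplexEdge n := by
  rw [simplexEdge, ← Real.sqrt_sq (norm_nonneg (u j - u i)), norm_sub_sq_real, h.norm_eq_one,
    h.norm_eq_one, h, if_neg hij.symm]
  congr 1
  field_simp
  ring

lemma injective (hn : 0 < n) (h : IsRegularSimplex u) : Function.Injective u := by
  intro i j hij
  by_contra hne
  have hedge := h.norm_sub_eq hn hne
  rw [hij, sub_self, norm_zero] at hedge
  exact (simplexEdge_pos hn).ne hedge

lemma sumDist_eq (hn : 0 < n) (h : IsRegularSimplex u) : sumDist u = simplexSum n := by
  rw [simplexSum, ← sum_card_Ioi, sumDist, Finset.sum_mul]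
  refine Finset.sum_congr rfl fun i _ ↦ ?_
  rw [Finset.sum_mul]
  exact Finset.sum_congr rfl fun j hj ↦ by
    rw [h.norm_sub_eq hn (Finset.mem_Ioi.1 hj).ne, one_mul]

end IsRegularSimplex

lemma isRegularSimplex_of_sumDist_eq (hn : 0 < n) {u : Fin (n + 1) → V} (hu : ∀ i, ‖u i‖ ≤ 1)
    (h : sumDist u = simplexSum n) : IsRegularSimplex u := by
  have hsum := simplexSum_sub_sumDist hn u
  rw [h, sub_self, mul_zero] at hsum
  have hsphere := sum_one_sub_norm_sq_nonneg hu
  have hedges : 0 ≤ ∑ i, ∑ j ∈ Finset.Ioi i, (‖u j - u i‖ - simplexEdge n) ^ 2 := by positivity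
  have hnorm (i) : ‖u i‖ ^ 2 = 1 := by
    have hzero : ∑ i, (1 - ‖u i‖ ^ 2) = 0 := by nlinarith [sq_nonneg ‖∑ i, u i‖]
    rw [Finset.sum_eq_zero_iff_of_nonneg fun i _ ↦
      sub_nonneg.2 (pow_le_one₀ (norm_nonneg _) (hu i))] at hzero
    linarith [hzero i (Finset.mem_univ i)]
  have hlt (i j) (hij : i < j) : ‖u j - u i‖ = simplexEdge n := by
    have hzero : ∑ i, ∑ j ∈ Finset.Ioi i, (‖u j - u i‖ - simplexEdge n) ^ 2 = 0 := by
      have := mul_nonneg (by positivity : (0 : ℝ) ≤ n + 1) hsphere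
      linarith [sq_nonneg ‖∑ i, u i‖]
    rw [Finset.sum_eq_zero_iff_of_nonneg fun _ _ ↦ by positivity] at hzero
    have hi := hzero i (Finset.mem_univ i)
    rw [Finset.sum_eq_zero_iff_of_nonneg fun _ _ ↦ by positivity] at hi
    exact sub_eq_zero.1 (pow_eq_zero_iff two_ne_zero |>.1 (hi j (Finset.mem_Ioi.2 hij)))
  intro i j
  split_ifs with hij
  · rw [hij, real_inner_self_eq_norm_sq, hnorm]
  · have hdist : ‖u j - u i‖ = simplexEdge n :=
      (lt_or_gt_of_ne hij).elim (hlt i j) fun h ↦ (norm_sub_rev _ _).trans (hlt j i h)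
    have hinner := norm_sub_sq_real (u j) (u i)
    rw [hdist, hnorm, hnorm, simplexEdge_sq, real_inner_comm] at hinner
    field_simp at hinner ⊢
    linarith

end Maximum

section Frame

variable {n : ℕ}

/- The standard simplex in `ℝⁿ⁺¹`, centred and rescaled, lies in the hyperplane orthogonal to
`(1, …, 1)`. -/
lemma exists_isRegularSimplex (hn : 0 < n) :
    ∃ u : Fin (n + 1) → EuclideanSpace ℝ (Fin n), IsRegularSimplex u := by
  let o : EuclideanSpace ℝ (Fin (n + 1)) := WithLp.toLp 2 fun _ ↦ 1
  have ho : o ≠ 0 := fun h ↦ one_ne_zero (congrArg (fun v ↦ v 0) h)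
  have hoo : ⟪o, o⟫ = n + 1 := by rw [PiLp.inner_apply]; simp [o]
  have hoe (i : Fin (n + 1)) : ⟪o, EuclideanSpace.single i 1⟫ = 1 := by
    simp [EuclideanSpace.inner_single_right, o]
  have hn' : (n + 1 : ℝ) ≠ 0 := by positivity
  have : Fact (Module.finrank ℝ (EuclideanSpace ℝ (Fin (n + 1))) = n + 1) :=
    ⟨finrank_euclideanSpace_fin⟩
  let w (i : Fin (n + 1)) : (ℝ ∙ o)ᗮ := ⟨EuclideanSpace.single i 1 - (n + 1 : ℝ)⁻¹ • o, by
    rw [Submodule.mem_orthogonal_singleton_iff_inner_right, inner_sub_right, inner_smul_right,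
      hoe, hoo, inv_mul_cancel₀ hn', sub_self]⟩
  have hww (i j : Fin (n + 1)) : ⟪w i, w j⟫ = (if i = j then 1 else 0) - (n + 1 : ℝ)⁻¹ := by
    simp only [w, Submodule.coe_inner, inner_sub_left, inner_sub_right, real_inner_smul_left,
      real_inner_smul_right, hoe, hoo, real_inner_comm o,
      orthonormal_iff_ite.1 EuclideanSpace.orthonormal_single i j]
    field_simp
    ring
  refine ⟨fun i ↦ √((n + 1) / n) • (OrthonormalBasis.fromOrthogonalSpanSingleton n ho).repr (w i),
    fun i j ↦ ?_⟩
  rw [real_inner_smul_left, real_inner_smul_right, LinearIsometryEquiv.inner_map_map, hww,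
    ← mul_assoc, Real.mul_self_sqrt (by positivity)]
  split_ifs <;> field_simp <;> ring

variable (n) in
/-- The matrix of the inner products of the vertices of a regular simplex inscribed in the unit
sphere. -/
def simplexGram : Matrix (Fin (n + 1)) (Fin (n + 1)) ℝ := .of fun s t ↦ if s = t then 1 else -1 / n

lemma simplexGram_mul_self (hn : 0 < n) :
    simplexGram n * simplexGram n = ((n + 1 : ℝ) / n) • simplexGram n := by
  let J : Matrix (Fin (n + 1)) (Fin (n + 1)) ℝ := .of fun _ _ ↦ 1
  have hJ : J * J = (n + 1 : ℝ) • J := by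
    ext s t
    simp [J, Matrix.mul_apply]
  have hG : simplexGram n = ((n + 1 : ℝ) / n) • 1 - (1 / n : ℝ) • J := by
    ext s t
    rcases eq_or_ne s t with rfl | hne
    · simp only [simplexGram, J, if_true, Matrix.sub_apply, Matrix.smul_apply, Matrix.one_apply_eq,
        Matrix.of_apply, smul_eq_mul, mul_one]
      field_simp
      ring
    · simp [simplexGram, J, hne, neg_div]
  rw [hG]
  simp only [Matrix.sub_mul, Matrix.mul_sub, Matrix.smul_mul, Matrix.mul_smul, Matrix.one_mul,
    Matrix.mul_one, hJ]
  module

lemma IsRegularSimplex.sum_mul_eq (hn : 0 < n) {u : Fin (n + 1) → EuclideanSpace ℝ (Fin n)}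
    (h : IsRegularSimplex u) (a b : Fin n) :
    ∑ s, u s a * u s b = if a = b then (n + 1 : ℝ) / n else 0 := by
  set κ : ℝ := (n + 1) / n with hκ
  have htr_one : (n : ℝ) * κ = n + 1 := by rw [hκ]; field_simp
  let U : Matrix (Fin n) (Fin (n + 1)) ℝ := .of fun a s ↦ u s a
  let S := U * U.transpose
  have hgram : U.transpose * U = simplexGram n := by
    ext s t
    rw [simplexGram, Matrix.of_apply, ← h s t]
    simp [Matrix.mul_apply, PiLp.inner_apply, U, mul_comm]
  have hgram_sq : U.transpose * U * (U.transpose * U) = κ • (U.transpose * U) := by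
    rw [hgram, simplexGram_mul_self hn]
  have htrace : S.trace = n * κ := by
    rw [Matrix.trace_mul_comm, hgram, htr_one]
    simp [Matrix.trace, simplexGram]
  have htrace_sq : (S * S).trace = κ * (n * κ) := by
    rw [← htrace, Matrix.mul_assoc, Matrix.trace_mul_comm, Matrix.trace_mul_comm U,
      ← smul_eq_mul, ← Matrix.trace_smul, ← hgram_sq]
    simp only [S, Matrix.mul_assoc]
  have hzero : ((S - κ • 1).conjTranspose * (S - κ • 1)).trace = 0 := by
    have hsymm : S.transpose = S := by simp [S, Matrix.transpose_mul]
    simp only [Matrix.conjTranspose_eq_transpose_of_trivial, Matrix.transpose_sub, hsymm,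
      Matrix.transpose_smul, Matrix.transpose_one, Matrix.sub_mul, Matrix.mul_sub,
      Matrix.smul_mul, Matrix.mul_smul, Matrix.one_mul, Matrix.mul_one, Matrix.trace_sub,
      Matrix.trace_smul, Matrix.trace_one, htrace, htrace_sq, Fintype.card_fin, smul_eq_mul]
    ring
  have hS := sub_eq_zero.1 (Matrix.trace_conjTranspose_mul_self_eq_zero_iff.1 hzero)
  simpa [S, Matrix.mul_apply, U, Matrix.one_apply] using congrFun₂ hS a b

end Frame

/-! ### Sums of distances in small balls -/

lemma tendsto_nhdsGT_zero {f : ℝ → ℝ} (hf : Continuous f) (h0 : f 0 = 0)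
    (hpos : ∀ᶠ t in 𝓝[>] 0, 0 < f t) : Tendsto f (𝓝[>] 0) (𝓝[>] 0) :=
  tendsto_nhdsWithin_iff.2 ⟨(hf.tendsto' 0 0 h0).mono_left nhdsWithin_le_nhds, hpos⟩

/- Near a maximizer of `f` the claim follows from the continuity of `g`; elsewhere `f` stays away
from its maximum. -/
lemma eventually_forall_sub_mul_le_of_isCompact {X : Type*} [TopologicalSpace X] {K : Set X}
    (hK : IsCompact K) {f g : X → ℝ} {Λ G b η : ℝ} (hf : Continuous f) (hfΛ : ∀ u ∈ K, f u ≤ Λ)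
    (hgb : ∀ u ∈ K, b ≤ g u) (hmax : ∀ u ∈ K, f u = Λ → ContinuousAt g u ∧ g u = G)
    (hη : 0 < η) :
    ∀ᶠ t in 𝓝[>] (0 : ℝ), ∀ u ∈ K, f u - t * g u ≤ Λ - t * (G - η) := by
  have hlocal : ∀ᶠ t in 𝓝 (0 : ℝ), ∀ u ∈ K, 0 < t → u ∈ K → f u - t * g u ≤ Λ - t * (G - η) := by
    refine hK.eventually_forall_of_forall_eventually fun v hv ↦ ?_
    rcases (hfΛ v hv).lt_or_eq with hlt | heq
    · have hgap : ∀ᶠ p : ℝ × X in 𝓝 (0, v), f p.2 + p.1 * (G - η - b) < Λ :=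
        (Continuous.continuousAt (by fun_prop)).eventually_lt continuousAt_const
          (by simpa using hlt)
      filter_upwards [hgap] with p hp ht hu
      have := mul_le_mul_of_nonneg_left (hgb p.2 hu) ht.le
      linarith
    · obtain ⟨hcont, hG⟩ := hmax v hv heq
      have hg : ∀ᶠ u in 𝓝 v, G - η < g u := hcont.eventually_const_lt (by linarith)
      filter_upwards [(continuous_snd.tendsto (0, v)).eventually hg] with p hp ht hu
      have := mul_le_mul_of_nonneg_left hp.le ht.le
      linarith [hfΛ p.2 hu]
  filter_upwards [nhdsWithin_le_nhds hlocal, self_mem_nhdsWithin] with t ht ht0 u hu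
  exact ht u hu ht0 hu

namespace MetricJet

section Sums

variable {E : Type*} [NormedAddCommGroup E] [InnerProductSpace ℝ E] [CompleteSpace E]
  (J : MetricJet E) {q : ℕ}

/-- The third order term in the sum of the pairwise distances of finitely many points, in normal
coordinates. -/
def sumCurv (u : Fin q → E) : ℝ :=
  ∑ i, ∑ j ∈ Finset.Ioi i, J.curv (u j - u i) (u i) / (6 * ‖u j - u i‖)

lemma sum_approxDist (u : Fin q → E) :
    ∑ i, ∑ j ∈ Finset.Ioi i, J.approxDist (u i) (u j) = sumDist u - J.sumCurv u := by
  simp only [approxDist, sumDist, sumCurv, Finset.sum_sub_distrib]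

lemma sumCurv_smul {t : ℝ} (ht : 0 < t) (u : Fin q → E) :
    J.sumCurv (t • u) = t ^ 3 * J.sumCurv u := by
  simp only [sumCurv, Pi.smul_apply, ← smul_sub, norm_smul, Real.norm_of_nonneg ht.le,
    Finset.mul_sum, curv_smul_left, curv_smul_right]
  refine Finset.sum_congr rfl fun i _ ↦ Finset.sum_congr rfl fun j _ ↦ ?_
  field_simp

lemma continuousAt_sumCurv {u : Fin q → E} (hu : Function.Injective u) :
    ContinuousAt J.sumCurv u := by
  unfold sumCurv
  refine tendsto_finsetSum _ fun i _ ↦ tendsto_finsetSum _ fun j hj ↦ ?_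
  have hcurv : Continuous fun u : Fin q → E ↦ J.curv (u j - u i) (u i) :=
    J.continuous_curv.comp (f := fun u : Fin q → E ↦ (u j - u i, u i)) (by fun_prop)
  have hnorm : Continuous fun u : Fin q → E ↦ 6 * ‖u j - u i‖ := by fun_prop
  have hne : u j - u i ≠ 0 := sub_ne_zero.2 (hu.ne (Finset.mem_Ioi.1 hj).ne')
  exact hcurv.continuousAt.div hnorm.continuousAt (by positivity)

lemma curv_sub_left (a u : E) : J.curv (a - u) u = J.curv a u := by
  have h := J.curv_add_smul u a (-1)
  rwa [neg_one_smul, ← sub_eq_add_neg, curv_symm, J.curv_symm u a] at h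

lemma abs_sumCurv_le {u : Fin q → E} (hu : ∀ i, ‖u i‖ ≤ 1) :
    |J.sumCurv u| ≤ J.curvBound / 6 * sumDist u := by
  simp only [sumCurv, sumDist, Finset.mul_sum]
  refine (Finset.abs_sum_le_sum_abs _ _).trans (Finset.sum_le_sum fun i _ ↦ ?_)
  refine (Finset.abs_sum_le_sum_abs _ _).trans (Finset.sum_le_sum fun j _ ↦ ?_)
  calc _ ≤ J.curvBound * ‖u i‖ ^ 2 * ‖u j - u i‖ / 6 := J.abs_curv_div_le _ _
    _ ≤ J.curvBound * 1 ^ 2 * ‖u j - u i‖ / 6 := by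
      have := J.curvBound_nonneg
      gcongr
      exact hu i
    _ = J.curvBound / 6 * ‖u j - u i‖ := by ring

end Sums

section Simplex

variable {n : ℕ} (J : MetricJet (EuclideanSpace ℝ (Fin n)))

local notation "𝔼" => EuclideanSpace ℝ (Fin n)

lemma sum_sum_curv {ι : Type*} [Fintype ι] {κ : ℝ} {u : ι → 𝔼}
    (hu : ∀ a b, ∑ s, u s a * u s b = if a = b then κ else 0) :
    ∑ s, ∑ t, J.curv (u s) (u t) = κ ^ 2 * J.scal := by
  have hframe (w : 𝔼) :
      ∑ s, J.curv (u s) w = κ * ∑ a : Fin n, J.curv (EuclideanSpace.single a 1) w := by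
    simp only [curv, ← sum_frame_eq (fun a b ↦ (hu a b).symm) (J.curvForm w), ite_mul, zero_mul,
      Finset.sum_ite_eq, Finset.mem_univ, if_true, Finset.mul_sum]
  calc ∑ s, ∑ t, J.curv (u s) (u t)
      = ∑ a : Fin n, κ * ∑ t, J.curv (EuclideanSpace.single a 1) (u t) := by
        rw [Finset.sum_comm]
        simp only [hframe, Finset.mul_sum]
        exact Finset.sum_comm
    _ = κ ^ 2 * J.scal := by
        simp only [J.curv_symm (EuclideanSpace.single _ 1) (u _), hframe, ← Finset.mul_sum, scal]
        ring

lemma sumCurv_of_isRegularSimplex (hn : 0 < n) {u : Fin (n + 1) → 𝔼} (hu : IsRegularSimplex u) :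
    J.sumCurv u = simplexSum n / (12 * n ^ 2) * J.scal := by
  have hedge := simplexEdge_pos hn
  have hn' : (n : ℝ) ≠ 0 := by positivity
  have hpairs : 2 * ∑ i, ∑ j ∈ Finset.Ioi i, J.curv (u i) (u j) = ((n + 1) / n) ^ 2 * J.scal := by
    rw [← J.sum_sum_curv (hu.sum_mul_eq hn), sum_sum_eq_two_mul_sum_Ioi _ fun i j ↦ J.curv_symm _ _]
    simp only [curv_self, Finset.sum_const_zero, zero_add]
  have hsum : J.sumCurv u =
      (∑ i, ∑ j ∈ Finset.Ioi i, J.curv (u i) (u j)) / (6 * simplexEdge n) := by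
    simp only [sumCurv, Finset.sum_div]
    refine Finset.sum_congr rfl fun i _ ↦ Finset.sum_congr rfl fun j hj ↦ ?_
    rw [hu.norm_sub_eq hn (Finset.mem_Ioi.1 hj).ne, curv_sub_left, curv_symm]
  rw [hsum, simplexSum, div_eq_iff (by positivity)]
  field_simp at hpairs ⊢
  refine mul_left_cancel₀ hn' ?_
  linear_combination 12 * hpairs - 6 * (n + 1) * J.scal * mul_simplexEdge_sq hn

lemma eventually_sumDist_sub_le (hn : 0 < n) {η : ℝ} (hη : 0 < η) :
    ∀ᶠ t in 𝓝[>] (0 : ℝ), ∀ u : Fin (n + 1) → 𝔼, (∀ i, ‖u i‖ ≤ 1) →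
      sumDist u - t * J.sumCurv u ≤
        simplexSum n - t * (simplexSum n / (12 * n ^ 2) * J.scal - η) := by
  have hmem (u : Fin (n + 1) → 𝔼) : u ∈ Metric.closedBall 0 1 ↔ ∀ i, ‖u i‖ ≤ 1 := by
    rw [mem_closedBall_zero_iff, pi_norm_le_iff_of_nonneg zero_le_one]
  simp only [← hmem]
  refine eventually_forall_sub_mul_le_of_isCompact (isCompact_closedBall _ _)
    (b := -(J.curvBound / 6 * simplexSum n)) continuous_sumDist ?_ ?_ ?_ hη
  · exact fun u hu ↦ sumDist_le_of_norm_le_one hn ((hmem u).1 hu)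
  · intro u hu
    have hbound : J.curvBound / 6 * sumDist u ≤ J.curvBound / 6 * simplexSum n := by
      have := J.curvBound_nonneg
      gcongr
      exact sumDist_le_of_norm_le_one hn ((hmem u).1 hu)
    exact neg_le_of_abs_le ((J.abs_sumCurv_le ((hmem u).1 hu)).trans hbound)
  · intro u hu heq
    have hreg := isRegularSimplex_of_sumDist_eq hn ((hmem u).1 hu) heq
    exact ⟨J.continuousAt_sumCurv (hreg.injective hn), J.sumCurv_of_isRegularSimplex hn hreg⟩

lemma eventually_sum_approxDist_le (hn : 0 < n) {η : ℝ} (hη : 0 < η) :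
    ∀ᶠ r in 𝓝[>] (0 : ℝ), ∀ z : Fin (n + 1) → 𝔼, (∀ i, ‖z i‖ ≤ r) →
      ∑ i, ∑ j ∈ Finset.Ioi i, J.approxDist (z i) (z j) ≤
        r * (simplexSum n - r ^ 2 * (simplexSum n / (12 * n ^ 2) * J.scal - η)) := by
  have hsq : Tendsto (fun r : ℝ ↦ r ^ 2) (𝓝[>] 0) (𝓝[>] 0) :=
    tendsto_nhdsGT_zero (by fun_prop) (zero_pow two_ne_zero) <|
      eventually_mem_nhdsWithin.mono fun _ hr ↦ pow_pos hr 2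
  filter_upwards [hsq.eventually (J.eventually_sumDist_sub_le hn hη), self_mem_nhdsWithin]
    with r hr (hr0 : 0 < r) z hz
  have hz_eq : z = r • (r⁻¹ • z) := by rw [smul_smul, mul_inv_cancel₀ hr0.ne', one_smul]
  have hunit (i : Fin (n + 1)) : ‖(r⁻¹ • z) i‖ ≤ 1 := by
    rw [Pi.smul_apply, norm_smul, norm_inv, Real.norm_of_nonneg hr0.le, inv_mul_le_one₀ hr0]
    exact hz i
  calc ∑ i, ∑ j ∈ Finset.Ioi i, J.approxDist (z i) (z j)
      = r * (sumDist (r⁻¹ • z) - r ^ 2 * J.sumCurv (r⁻¹ • z)) := by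
        rw [sum_approxDist]
        conv_lhs => rw [hz_eq, sumDist_smul hr0.le, sumCurv_smul J hr0]
        ring
    _ ≤ _ := mul_le_mul_of_nonneg_left (hr _ hunit) hr0.le

lemma sum_approxDist_smul_simplex (hn : 0 < n) {u : Fin (n + 1) → 𝔼} (hu : IsRegularSimplex u)
    {r : ℝ} (hr : 0 < r) :
    ∑ i, ∑ j ∈ Finset.Ioi i, J.approxDist ((r • u) i) ((r • u) j) =
      r * (simplexSum n - r ^ 2 * (simplexSum n / (12 * n ^ 2) * J.scal)) := by
  rw [sum_approxDist, sumDist_smul hr.le, sumCurv_smul J hr, hu.sumDist_eq hn,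
    J.sumCurv_of_isRegularSimplex hn hu]
  ring

end Simplex

end MetricJet

/-- The supremum of the sums of the pairwise distances of `q` points, which is `extent q X` without
its normalizing factor. -/
def supSum (q : ℕ) (X : Type*) [PseudoEMetricSpace X] : ℝ≥0∞ :=
  ⨆ p : Fin q → X, ∑ i, ∑ j ∈ Finset.Ioi i, edist (p i) (p j)

lemma toReal_extent_div {q : ℕ} (hq : 2 ≤ q) (X Y : Type*) [PseudoEMetricSpace X]
    [PseudoEMetricSpace Y] :
    (extent q X).toReal / (extent q Y).toReal = (supSum q X).toReal / (supSum q Y).toReal := by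
  have hc : (0 : ℝ) < q.choose 2 := by exact_mod_cast Nat.choose_pos hq
  simp only [extent, supSum, ENNReal.toReal_mul, ENNReal.toReal_inv, ENNReal.toReal_natCast]
  exact mul_div_mul_left _ _ (inv_ne_zero hc.ne')

lemma sum_edist_eq_ofReal_sumDist {V : Type*} [NormedAddCommGroup V] {q : ℕ} (u : Fin q → V) :
    ∑ i, ∑ j ∈ Finset.Ioi i, edist (u i) (u j) = ENNReal.ofReal (sumDist u) := by
  rw [sumDist, ENNReal.ofReal_sum_of_nonneg fun i _ ↦ by positivity]
  refine Finset.sum_congr rfl fun i _ ↦ ?_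
  rw [ENNReal.ofReal_sum_of_nonneg fun j _ ↦ norm_nonneg _]
  exact Finset.sum_congr rfl fun j _ ↦ by rw [edist_comm, edist_dist, dist_eq_norm]

lemma supSum_closedEBall_euclidean {n : ℕ} (hn : 0 < n) {ε : ℝ} (hε : 0 < ε) :
    supSum (n + 1) (Metric.closedEBall (0 : EuclideanSpace ℝ (Fin n)) (ENNReal.ofReal ε)) =
      ENNReal.ofReal (ε * simplexSum n) := by
  have hmem (y : EuclideanSpace ℝ (Fin n)) :
      y ∈ Metric.closedEBall 0 (ENNReal.ofReal ε) ↔ ‖y‖ ≤ ε := by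
    rw [Metric.mem_closedEBall, edist_dist, ENNReal.ofReal_le_ofReal_iff hε.le, dist_zero_right]
  simp only [supSum, Subtype.edist_eq, sum_edist_eq_ofReal_sumDist]
  refine le_antisymm (iSup_le fun p ↦ ENNReal.ofReal_le_ofReal ?_) ?_
  · exact sumDist_le hn hε fun i ↦ (hmem _).1 (p i).2
  · obtain ⟨u, hu⟩ := exists_isRegularSimplex hn
    have hball (i : Fin (n + 1)) : ‖(ε • u) i‖ ≤ ε := by
      rw [Pi.smul_apply, norm_smul, hu.norm_eq_one, Real.norm_of_nonneg hε.le, mul_one]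
    refine le_iSup_of_le (fun i ↦ ⟨(ε • u) i, (hmem _).2 (hball i)⟩) ?_
    rw [← hu.sumDist_eq hn, ← sumDist_smul hε.le]

/- The difference of the two sides is `ε ^ 3` times an expression that tends to
`2 * δ * Λ + c - η`. -/
lemma eventually_cubic_le {Λ G c δ η : ℝ} (h : 2 * δ * Λ + c < η) : ∀ᶠ ε in 𝓝[>] (0 : ℝ),
    (1 + δ * ε ^ 2) * ε * (Λ - ((1 + δ * ε ^ 2) * ε) ^ 2 * (G - c)) +
      δ * ε ^ 2 * ((1 + δ * ε ^ 2) * ε * Λ) ≤ ε * (Λ - ε ^ 2 * (G - η)) := by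
  have hneg : ∀ᶠ ε in 𝓝 (0 : ℝ),
      δ * Λ - (1 + δ * ε ^ 2) ^ 3 * (G - c) + δ * (1 + δ * ε ^ 2) * Λ + (G - η) < 0 :=
    (Continuous.continuousAt (by fun_prop)).eventually_lt continuousAt_const (by norm_num; linarith)
  filter_upwards [nhdsWithin_le_nhds hneg, self_mem_nhdsWithin] with ε hε (hpos : 0 < ε)
  have := mul_neg_of_pos_of_neg (pow_pos hpos 3) hε
  linarith

namespace NormalChart

section Sums

variable {M : Type*} [PseudoEMetricSpace M] {x : M} {E : Type*} [NormedAddCommGroup E]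
  [InnerProductSpace ℝ E] [CompleteSpace E] (N : NormalChart x E) {δ : ℝ}

lemma eventually_abs_edist_sub_le (hδ : 0 < δ) : ∀ᶠ ε in 𝓝[>] (0 : ℝ), ∀ u v,
    ‖u‖ ≤ 2 * ε → ‖v‖ ≤ 2 * ε → edist (N.toFun u) (N.toFun v) ≠ ⊤ ∧
      |(edist (N.toFun u) (N.toFun v)).toReal - N.jet.approxDist u v| ≤
        δ * ε ^ 2 * ‖v - u‖ := by
  have htwo : Tendsto (fun ε : ℝ ↦ 2 * ε) (𝓝[>] 0) (𝓝[>] 0) :=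
    tendsto_nhdsGT_zero (by fun_prop) (mul_zero 2) <|
      eventually_mem_nhdsWithin.mono fun _ hε ↦ mul_pos two_pos hε
  filter_upwards [htwo.eventually (N.abs_edist_sub_approxDist_le (by positivity : 0 < δ / 4))]
    with ε hε u v hu hv
  convert hε u v hu hv using 3
  ring

lemma eventually_abs_edist_center_sub_le (hδ : 0 < δ) : ∀ᶠ ε in 𝓝[>] (0 : ℝ), ∀ z, ‖z‖ ≤ 2 * ε →
    edist x (N.toFun z) ≠ ⊤ ∧ |(edist x (N.toFun z)).toReal - ‖z‖| ≤ δ * ε ^ 3 := by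
  filter_upwards [N.eventually_abs_edist_sub_le (half_pos hδ), self_mem_nhdsWithin]
    with ε hdist (hε : 0 < ε) z hz
  have hcurv : N.jet.curv z 0 = 0 := by simpa using N.jet.curv_smul_right 0 z 0
  obtain ⟨hne, hle⟩ := hdist 0 z (by rw [norm_zero]; positivity) hz
  rw [MetricJet.approxDist, sub_zero, hcurv, zero_div, sub_zero, N.map_zero] at hle
  rw [N.map_zero] at hne
  refine ⟨hne, hle.trans ?_⟩
  calc δ / 2 * ε ^ 2 * ‖z‖ ≤ δ / 2 * ε ^ 2 * (2 * ε) := by gcongr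
    _ = δ * ε ^ 3 := by ring

lemma eventually_norm_inv_le (hδ : 0 < δ) : ∀ᶠ ε in 𝓝[>] (0 : ℝ), ∀ p,
    edist x p ≤ ENNReal.ofReal ε → N.toFun (N.inv p) = p ∧ ‖N.inv p‖ ≤ (1 + δ * ε ^ 2) * ε := by
  filter_upwards [N.eventually_abs_edist_center_sub_le hδ, eventually_mul_lt 1 N.outerRadius_pos,
    self_mem_nhdsWithin] with ε hcenter hR (hε : 0 < ε) p hp
  rw [one_mul] at hR
  have hpR : edist x p < ENNReal.ofReal N.outerRadius :=
    hp.trans_lt ((ENNReal.ofReal_lt_ofReal_iff N.outerRadius_pos).2 hR)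
  have hpε : (edist x p).toReal ≤ ε := ENNReal.toReal_le_of_le_ofReal hε.le hp
  have hinv : N.toFun (N.inv p) = p := N.right_inv p (by rwa [Metric.mem_eball, edist_comm])
  have hle := (hcenter (N.inv p) (by linarith [N.norm_inv_le hpR])).2
  rw [hinv] at hle
  refine ⟨hinv, ?_⟩
  linarith [neg_le_of_abs_le hle]

lemma eventually_toFun_mem_closedEBall (hδ : 0 < δ) : ∀ᶠ ε in 𝓝[>] (0 : ℝ), ∀ z,
    ‖z‖ ≤ (1 - δ * ε ^ 2) * ε → N.toFun z ∈ Metric.closedEBall x (ENNReal.ofReal ε) := by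
  filter_upwards [N.eventually_abs_edist_center_sub_le hδ, self_mem_nhdsWithin]
    with ε hcenter (hε : 0 < ε) z hz
  have hcube : 0 < δ * ε ^ 3 := by positivity
  obtain ⟨hne, hle⟩ := hcenter z (by linarith)
  rw [Metric.mem_closedEBall, edist_comm, ENNReal.le_ofReal_iff_toReal_le hne hε.le]
  linarith [le_of_abs_le hle]

lemma eventually_abs_sum_edist_sub_le (hδ : 0 < δ) (q : ℕ) : ∀ᶠ ε in 𝓝[>] (0 : ℝ),
    ∀ z : Fin q → E, (∀ i, ‖z i‖ ≤ 2 * ε) →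
      ∑ i, ∑ j ∈ Finset.Ioi i, edist (N.toFun (z i)) (N.toFun (z j)) ≠ ⊤ ∧
      |(∑ i, ∑ j ∈ Finset.Ioi i, edist (N.toFun (z i)) (N.toFun (z j))).toReal -
        ∑ i, ∑ j ∈ Finset.Ioi i, N.jet.approxDist (z i) (z j)| ≤ δ * ε ^ 2 * sumDist z := by
  filter_upwards [N.eventually_abs_edist_sub_le hδ] with ε hdist z hz
  have hne (i j : Fin q) : edist (N.toFun (z i)) (N.toFun (z j)) ≠ ⊤ :=
    (hdist _ _ (hz i) (hz j)).1
  have hne_sum (i : Fin q) : ∑ j ∈ Finset.Ioi i, edist (N.toFun (z i)) (N.toFun (z j)) ≠ ⊤ :=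
    ENNReal.sum_ne_top.2 fun j _ ↦ hne i j
  refine ⟨ENNReal.sum_ne_top.2 fun i _ ↦ hne_sum i, ?_⟩
  rw [ENNReal.toReal_sum fun i _ ↦ hne_sum i]
  simp only [ENNReal.toReal_sum fun j _ ↦ hne _ j, ← Finset.sum_sub_distrib, sumDist,
    Finset.mul_sum]
  refine (Finset.abs_sum_le_sum_abs _ _).trans (Finset.sum_le_sum fun i _ ↦ ?_)
  exact (Finset.abs_sum_le_sum_abs _ _).trans
    (Finset.sum_le_sum fun j _ ↦ (hdist _ _ (hz i) (hz j)).2)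

end Sums

section Extent

variable {M : Type*} [PseudoEMetricSpace M] {x : M} {n : ℕ}
  (N : NormalChart x (EuclideanSpace ℝ (Fin n))) {η : ℝ}

lemma eventually_supSum_closedEBall_le (hn : 0 < n) (hη : 0 < η) : ∀ᶠ ε in 𝓝[>] (0 : ℝ),
    supSum (n + 1) (Metric.closedEBall x (ENNReal.ofReal ε)) ≤ ENNReal.ofReal
      (ε * (simplexSum n - ε ^ 2 * (simplexSum n / (12 * n ^ 2) * N.jet.scal - η))) := by
  have hΛ := simplexSum_pos hn
  obtain ⟨δ, hδ, hδη⟩ : ∃ δ > 0, 2 * δ * simplexSum n + η / 2 < η :=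
    ⟨η / (8 * simplexSum n), by positivity, by field_simp; linarith⟩
  have hradius : Tendsto (fun ε ↦ (1 + δ * ε ^ 2) * ε) (𝓝[>] 0) (𝓝[>] 0) :=
    tendsto_nhdsGT_zero (by fun_prop) (mul_zero _) <|
      eventually_mem_nhdsWithin.mono fun ε (hε : 0 < ε) ↦ by positivity
  filter_upwards [N.eventually_norm_inv_le hδ, N.eventually_abs_sum_edist_sub_le hδ (n + 1),
    hradius.eventually (N.jet.eventually_sum_approxDist_le hn (half_pos hη)),
    eventually_cubic_le (G := simplexSum n / (12 * n ^ 2) * N.jet.scal) hδη,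
    eventually_mul_sq_le δ one_pos, self_mem_nhdsWithin]
    with ε hinv hsum happrox hcubic hδε (hε : 0 < ε)
  refine iSup_le fun p ↦ ?_
  have hp (i : Fin (n + 1)) := hinv (p i) ((edist_comm _ _).trans_le (p i).2)
  obtain ⟨hne, hle⟩ := hsum (fun i ↦ N.inv (p i)) fun i ↦
    (hp i).2.trans (mul_le_mul_of_nonneg_right (by linarith) hε.le)
  simp only [fun i ↦ (hp i).1, ← Subtype.edist_eq] at hne hle
  rw [← ENNReal.ofReal_toReal hne]
  refine ENNReal.ofReal_le_ofReal (le_trans ?_ hcubic)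
  have hdist := sumDist_le hn (by positivity) fun i ↦ (hp i).2
  have herr := mul_le_mul_of_nonneg_left hdist (by positivity : 0 ≤ δ * ε ^ 2)
  linarith [le_of_abs_le hle, happrox _ fun i ↦ (hp i).2]

lemma eventually_le_supSum_closedEBall (hn : 0 < n) (hη : 0 < η) : ∀ᶠ ε in 𝓝[>] (0 : ℝ),
    ENNReal.ofReal
      (ε * (simplexSum n - ε ^ 2 * (simplexSum n / (12 * n ^ 2) * N.jet.scal + η))) ≤
      supSum (n + 1) (Metric.closedEBall x (ENNReal.ofReal ε)) := by
  have hΛ := simplexSum_pos hn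
  obtain ⟨δ, hδ, hδη⟩ : ∃ δ > 0, 2 * -δ * -simplexSum n + 0 < η :=
    ⟨η / (4 * simplexSum n), by positivity, by field_simp; linarith⟩
  obtain ⟨u, hu⟩ := exists_isRegularSimplex hn
  filter_upwards [N.eventually_toFun_mem_closedEBall hδ,
    N.eventually_abs_sum_edist_sub_le hδ (n + 1),
    eventually_cubic_le (G := -(simplexSum n / (12 * n ^ 2) * N.jet.scal)) hδη,
    eventually_mul_sq_le (2 * δ) one_pos, self_mem_nhdsWithin]
    with ε hmem hsum hcubic hδε (hε : 0 < ε)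
  set r := (1 - δ * ε ^ 2) * ε with hr_def
  have hr : 0 < r := mul_pos (by linarith) hε
  have hr2 : r ≤ 2 * ε := by
    have hsq : 0 < δ * ε ^ 2 := by positivity
    exact mul_le_mul_of_nonneg_right (by linarith) hε.le
  have hnorm (i : Fin (n + 1)) : ‖(r • u) i‖ = r := by
    rw [Pi.smul_apply, norm_smul, hu.norm_eq_one, Real.norm_of_nonneg hr.le, mul_one]
  obtain ⟨hne, hle⟩ := hsum (r • u) fun i ↦ (hnorm i).trans_le hr2
  refine le_iSup_of_le (fun i ↦ ⟨N.toFun ((r • u) i), hmem _ (hnorm i).le⟩) ?_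
  simp only [Subtype.edist_eq]
  rw [ENNReal.ofReal_le_iff_le_toReal hne]
  rw [N.jet.sum_approxDist_smul_simplex hn hu hr, sumDist_smul hr.le, hu.sumDist_eq hn] at hle
  rw [neg_mul, ← sub_eq_add_neg, ← hr_def] at hcubic
  linarith [neg_le_of_abs_le hle]

theorem tendsto_supSum_closedEBall (hn : 0 < n) :
    Tendsto (fun ε : ℝ ↦ (simplexSum n -
        (supSum (n + 1) (Metric.closedEBall x (ENNReal.ofReal ε))).toReal / ε) / ε ^ 2)
      (𝓝[>] 0) (𝓝 (simplexSum n / (12 * n ^ 2) * N.jet.scal)) := by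
  have hΛ := simplexSum_pos hn
  set G := simplexSum n / (12 * n ^ 2) * N.jet.scal
  rw [Metric.tendsto_nhds]
  intro η hη
  filter_upwards [N.eventually_supSum_closedEBall_le hn (half_pos hη),
    N.eventually_le_supSum_closedEBall hn (half_pos hη), eventually_mul_sq_le (G - η / 2) hΛ,
    self_mem_nhdsWithin] with ε hup hlow hnonneg (hε : 0 < ε)
  have hne := ne_top_of_le_ne_top ENNReal.ofReal_ne_top hup
  have hup' := ENNReal.toReal_le_of_le_ofReal (mul_nonneg hε.le (by linarith)) hup
  have hlow' := (ENNReal.ofReal_le_iff_le_toReal hne).1 hlow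
  rw [← div_le_iff₀' hε] at hup'
  rw [← le_div_iff₀' hε] at hlow'
  refine (abs_le.2 ⟨?_, ?_⟩ : |_ - G| ≤ η / 2).trans_lt (half_lt_self hη)
  · rw [neg_le_sub_iff_le_add, ← sub_le_iff_le_add, le_div_iff₀ (by positivity)]
    linarith
  · rw [sub_le_iff_le_add, div_le_iff₀ (by positivity)]
    linarith

end Extent

end NormalChart

end

theorem corollary1p2_general {n : ℕ} {H : Type*} [TopologicalSpace H]
    (I : ModelWithCorners ℝ (EuclideanSpace ℝ (Fin n)) H)
    {M : Type*} [PseudoEMetricSpace M] [ChartedSpace H M] [IsManifold I 3 M]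
    [Bundle.RiemannianBundle (fun x : M ↦ TangentSpace I x)]
    [IsContMDiffRiemannianBundle I 2 (EuclideanSpace ℝ (Fin n)) (fun x : M ↦ TangentSpace I x)]
    [IsRiemannianManifold I M]
    (x : M) (hx : I.IsInteriorPoint x) :
    Filter.Tendsto
      (fun ε : ℝ ↦ 12 * (n : ℝ) ^ 2 / ε ^ 2 *
        (1 - (extent (n + 1) (Metric.closedEBall x (ENNReal.ofReal ε))).toReal /
          (extent (n + 1) (Metric.closedEBall (0 : EuclideanSpace ℝ (Fin n))
            (ENNReal.ofReal ε))).toReal))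
      (nhdsWithin 0 (Set.Ioi 0)) (nhds (scalarCurvature I x)) := by
  rcases n.eq_zero_or_pos with rfl | hn
  · simp [scalarCurvature]
  obtain ⟨N, hN⟩ := RiemannianCoord.exists_normalChart I hx
  have hΛ := simplexSum_pos hn
  have hlim := (N.tendsto_supSum_closedEBall hn).const_mul (12 * n ^ 2 / simplexSum n)
  have hG : 12 * n ^ 2 / simplexSum n * (simplexSum n / (12 * n ^ 2) * N.jet.scal) =
      scalarCurvature I x := by
    rw [← hN]
    field_simp
  rw [hG] at hlim
  refine hlim.congr' ?_
  filter_upwards [self_mem_nhdsWithin] with ε (hε : 0 < ε)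
  rw [toReal_extent_div (by lia), supSum_closedEBall_euclidean hn hε,
    ENNReal.toReal_ofReal (by positivity)]
  field_simp

theorem corollary1p2 {n : ℕ} {H : Type*} [TopologicalSpace H]
    (I : ModelWithCorners ℝ (EuclideanSpace ℝ (Fin n)) H)
    {M : Type*} [EMetricSpace M] [ChartedSpace H M] [IsManifold I ∞ M]
    [Bundle.RiemannianBundle (fun x : M ↦ TangentSpace I x)]
    [IsContMDiffRiemannianBundle I ∞ (EuclideanSpace ℝ (Fin n)) (fun x : M ↦ TangentSpace I x)]
    [IsRiemannianManifold I M]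
    (x : M) (hx : I.IsInteriorPoint x) :
    Filter.Tendsto
      (fun ε : ℝ ↦ 12 * (n : ℝ) ^ 2 / ε ^ 2 *
        (1 - (extent (n + 1) (Metric.closedEBall x (ENNReal.ofReal ε))).toReal /
          (extent (n + 1) (Metric.closedEBall (0 : EuclideanSpace ℝ (Fin n))
            (ENNReal.ofReal ε))).toReal))
      (nhdsWithin 0 (Set.Ioi 0)) (nhds (scalarCurvature I x)) := by
  have : IsContMDiffRiemannianBundle I 2 (EuclideanSpace ℝ (Fin n))
      (fun x : M ↦ TangentSpace I x) := .of_le (n := ∞) (by norm_cast)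
  exact corollary1p2_general I x hx
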